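/- Let $(\mathcal G,\rho)$ be a Real groupoid: a locally compact Hausdorff topological groupoid $\mathcal G$ with unit space $X$, source $s$ and range $r$, together with a strict involutive homeomorphism $\rho$ (of $\mathcal G$ and of $X$). For $n\ge 0$ let $\mathcal G_n$ be the space of composable $n$-tuples (with $\mathcal G_0=X$), i.e. of strict morphisms $\vec g:[n]\times[n]\to\mathcal G$ from the pair groupoid on $[n]=\{0,\dots,n\}$; with the maps $\tilde f(\vec g)=\vec g\circ(f\times f)$ for nondecreasing $f:[m]\to[n]$ and the involutions $\rho_n$ induced by $\rho$, these form a Real simplicial space $(\mathcal G_\bullet,\rho_\bullet)$. Suppose that $\mathcal G$ is proper (the map $(s,r):\mathcal G\to X\times X$ is proper), that each $\mathcal G_n$ and the orbit space $X/\mathcal G$ are paracompact (e.g. that $\mathcal G$ is $\sigma$-compact), and that $\mathcal G$ has a (left) Haar system. Let $\mathbb K$ be either the additive group $\mathbb R$ with the involution $\bar t=-t$ or $\mathbb C$ with complex conjugation. A Real representation of $(\mathcal G,\rho)$ is a $\mathbb K$-vector bundle $\pi:E\to X$ of finite rank $k$ with an involution $\nu$ of $E$ covering $\rho$, which is fibrewise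 $\mathbb R$-linear if $\mathbb K=\mathbb R$ and antilinear if $\mathbb K=\mathbb C$, and with a continuous fibrewise linear left action of $\mathcal G$ satisfying $\nu(g\xi)=\rho(g)\nu(\xi)$, such that there are an open cover $(U_j)_{j\in I}$ of $X$, an involution $j\mapsto\bar j$ of $I$ with $U_{\bar j}=\rho(U_j)$, and trivializations $\phi_j:U_j\times\mathbb K^k\to E|_{U_j}$ with $\nu(\phi_j(x,a_1,\dots,a_k))=\phi_{\bar j}(\rho(x),\bar a_1,\dots,\bar a_k)$. It defines an abelian Real sheaf $E^\bullet$ on $\mathcal G_\bullet$: $E^n(U)$ is the group of continuous maps $c:U\to E$ with $\pi(c(\vec g))$ equal to the last vertex $\vec g(n,n)$ of $\vec g$, with $(\tilde f^*c)(\vec g)=\vec g(n,f(m))\cdot c(\tilde f\vec g)$ for $f:[m]\to[n]$, and with Real structure $(\sigma c)(\rho_n\vec g)=\nu(c(\vec g))$. A Real open cover $\mathcal U_\bullet$ of $\mathcal G_\bullet$ consists, for every $n$, of an open cover $(U^n_j)_{j\in J_n}$ of $\mathcal G_n$ and an involution of $J_n$ with $U^n_{\bar j}=\rho_n(U^n_j)$.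 Let $\Lambda_n$ be the set of families $\lambda=(\lambda_\varphi)$ with $\lambda_\varphi\in J_k$ for every increasing $\varphi:[k]\to[n]$ ($k\le n$), let $U^n_\lambda=\bigcap_\varphi\tilde\varphi^{-1}(U^k_{\lambda_\varphi})$, $\bar\lambda_\varphi=\overline{\lambda_\varphi}$ and $(\tilde f\lambda)_\varphi=\lambda_{f\circ\varphi}$. Let $HR^n(\mathcal U_\bullet,E^\bullet)$ be the $n$-th cohomology group of the complex of families $c=(c_\lambda)_{\lambda\in\Lambda_n}$, $c_\lambda\in E^n(U^n_\lambda)$, with $c_{\bar\lambda}=\sigma(c_\lambda)$, and with differential $(dc)_\lambda=\sum_{i=0}^{n+1}(-1)^i\tilde\varepsilon_i^*c_{\tilde\varepsilon_i\lambda}$, where $\varepsilon_i:[n]\to[n+1]$ is the increasing map avoiding $i$. Let $\check HR^n(\mathcal G_\bullet,E^\bullet)$ be the direct limit of the groups $HR^n(\mathcal U_\bullet,E^\bullet)$, under the maps induced by refinements commuting with the involutions, over the Real open covers $\mathcal U_\bullet$ for which, for some $N\ge n+1$, the index sets $J_0,\dots,J_N$ carry an $N$-truncated simplicial structure commuting with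 the involutions and with $\tilde f(U^n_j)\subseteq U^m_{\tilde f(j)}$ for all nondecreasing $f:[m]\to[n]$, $m,n\le N$. Theorem. For every Real representation $(E,\nu)$ of $(\mathcal G,\rho)$, $$\check HR^n(\mathcal G_\bullet,E^\bullet)=0\qquad\text{for all } n\ge 1.$$ -/

import Mathlib

open MeasureTheory TopologicalSpace

universe u u' v

/-! ### Topological groupoids with involution -/

/-- A topological groupoid with space of arrows `G` and space of units `X`; the product `g h` is
defined when `s g = r h`. -/
structure TopGroupoid (X : Type u') (G : Type u) [TopologicalSpace X] [TopologicalSpace G] where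
  s : G → X
  r : G → X
  unit : X → G
  inv : G → G
  mul : ∀ g h : G, s g = r h → G
  s_unit : ∀ x, s (unit x) = x
  r_unit : ∀ x, r (unit x) = x
  s_inv : ∀ g, s (inv g) = r g
  r_inv : ∀ g, r (inv g) = s g
  s_mul : ∀ g h e, s (mul g h e) = s h
  r_mul : ∀ g h e, r (mul g h e) = r g
  mul_assoc : ∀ g h k (e : s g = r h) (e' : s h = r k),
    mul (mul g h e) k ((s_mul g h e).trans e') = mul g (mul h k e') (e.trans (r_mul h k e').symm)
  unit_mul : ∀ g, mul (unit (r g)) g (s_unit (r g)) = g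
  mul_unit : ∀ g, mul g (unit (s g)) (r_unit (s g)).symm = g
  inv_mul : ∀ g, mul (inv g) g (s_inv g) = unit (s g)
  mul_inv : ∀ g, mul g (inv g) (r_inv g).symm = unit (r g)
  continuous_s : Continuous s
  continuous_r : Continuous r
  continuous_unit : Continuous unit
  continuous_inv : Continuous inv
  continuous_mul : Continuous fun p : {p : G × G // s p.1 = r p.2} => mul p.1.1 p.1.2 p.2

/-- A Real groupoid: a topological groupoid with a strict involutive homeomorphism, given by
`rho` on arrows and `rhoX` on units. -/
structure RealGroupoid (X : Type u') (G : Type u) [TopologicalSpace X] [TopologicalSpace G]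
    extends TopGroupoid X G where
  rho : G → G
  rhoX : X → X
  continuous_rho : Continuous rho
  continuous_rhoX : Continuous rhoX
  rho_rho : ∀ g, rho (rho g) = g
  rhoX_rhoX : ∀ x, rhoX (rhoX x) = x
  s_rho : ∀ g, s (rho g) = rhoX (s g)
  r_rho : ∀ g, r (rho g) = rhoX (r g)
  rho_unit : ∀ x, rho (unit x) = unit (rhoX x)
  rho_mul : ∀ g h (e : s g = r h),
    rho (mul g h e) = mul (rho g) (rho h) ((s_rho g).trans ((congrArg rhoX e).trans (r_rho h).symm))

namespace TopGroupoid

variable {X : Type u'} {G : Type u} [TopologicalSpace X] [TopologicalSpace G]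

/-- Two units are in the same orbit when an arrow joins them. -/
def orbitSetoid (𝓖 : TopGroupoid X G) : Setoid X where
  r x y := ∃ g, 𝓖.s g = x ∧ 𝓖.r g = y
  iseqv :=
    { refl := fun x => ⟨𝓖.unit x, 𝓖.s_unit x, 𝓖.r_unit x⟩
      symm := by
        rintro x y ⟨g, hs, hr⟩
        exact ⟨𝓖.inv g, (𝓖.s_inv g).trans hr, (𝓖.r_inv g).trans hs⟩
      trans := by
        rintro x y z ⟨g, hs, hr⟩ ⟨h, hs2, hr2⟩
        exact ⟨𝓖.mul h g (hs2.trans hr.symm), (𝓖.s_mul _ _ _).trans hs,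
          (𝓖.r_mul _ _ _).trans hr2⟩ }

/-- The orbit space `X / G`, with the quotient topology. -/
abbrev OrbitSpace (𝓖 : TopGroupoid X G) : Type u' := Quotient 𝓖.orbitSetoid

/-- The groupoid is proper when `(s, r) : G → X × X` is a proper map. -/
def IsProper (𝓖 : TopGroupoid X G) : Prop := IsProperMap fun g => (𝓖.s g, 𝓖.r g)

open Classical in
/-- A (left) Haar system: Radon measures `μ x` with support `G^x = r⁻¹(x)`, depending continuously
on `x`, and left invariant. -/
structure HaarSystem (𝓖 : TopGroupoid X G) [MeasurableSpace G] where
  μ : X → Measure G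
  regular : ∀ x, (μ x).Regular
  support_eq : ∀ x, (μ x).support = 𝓖.r ⁻¹' {x}
  continuous_integral : ∀ f : G → ℝ, Continuous f → HasCompactSupport f →
    Continuous fun x => ∫ g, f g ∂(μ x)
  left_invariant : ∀ (f : G → ℝ), Continuous f → HasCompactSupport f → ∀ g : G,
    ∫ h, (if e : 𝓖.s g = 𝓖.r h then f (𝓖.mul g h e) else 0) ∂(μ (𝓖.s g)) = ∫ h, f h ∂(μ (𝓖.r g))

/-- `G_n`: strict morphisms from the pair groupoid `[n] × [n]` to the groupoid, topologized as a
subspace of the product (homeomorphic to the space of composable `n`-tuples through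
`φ ↦ (φ 0 1, …, φ (n-1) n)`). -/
def Nerve (𝓖 : TopGroupoid X G) (n : ℕ) : Type u :=
  {φ : Fin (n + 1) → Fin (n + 1) → G //
    ∃ e : ∀ i j k, 𝓖.s (φ i j) = 𝓖.r (φ j k), ∀ i j k, 𝓖.mul (φ i j) (φ j k) (e i j k) = φ i k}

instance (𝓖 : TopGroupoid X G) (n : ℕ) : TopologicalSpace (𝓖.Nerve n) :=
  inferInstanceAs (TopologicalSpace {φ : Fin (n + 1) → Fin (n + 1) → G //
    ∃ e : ∀ i j k, 𝓖.s (φ i j) = 𝓖.r (φ j k), ∀ i j k, 𝓖.mul (φ i j) (φ j k) (e i j k) = φ i k})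

namespace Nerve

variable {𝓖 : TopGroupoid X G} {n : ℕ}

/-- The image in `X` of the vertex `i`. -/
def vert (φ : 𝓖.Nerve n) (i : Fin (n + 1)) : X := 𝓖.r (φ.1 i i)

theorem s_eq (φ : 𝓖.Nerve n) (i j : Fin (n + 1)) : 𝓖.s (φ.1 i j) = φ.vert j := by
  obtain ⟨e, -⟩ := φ.2
  exact e i j j

theorem r_eq (φ : 𝓖.Nerve n) (i j : Fin (n + 1)) : 𝓖.r (φ.1 i j) = φ.vert i := by
  obtain ⟨e, -⟩ := φ.2
  exact (e i i j).symm.trans (e i i i)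

theorem mul_eq (φ : 𝓖.Nerve n) (i j k : Fin (n + 1)) :
    𝓖.mul (φ.1 i j) (φ.1 j k) ((φ.s_eq i j).trans (φ.r_eq j k).symm) = φ.1 i k := by
  obtain ⟨e, h⟩ := φ.2
  exact h i j k

theorem diag_eq (φ : 𝓖.Nerve n) (i : Fin (n + 1)) : φ.1 i i = 𝓖.unit (φ.vert i) := by
  have key : ∀ (g : G) (e : 𝓖.s g = 𝓖.r g), 𝓖.mul g g e = g → g = 𝓖.unit (𝓖.r g) := by
    intro g e h
    have h1 := 𝓖.mul_assoc (𝓖.inv g) g g (𝓖.s_inv g) e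
    have h2 : ∀ (a b c : G) (ea : 𝓖.s a = 𝓖.r c) (eb : 𝓖.s b = 𝓖.r c), a = b →
        𝓖.mul a c ea = 𝓖.mul b c eb := by rintro a b c ea eb rfl; rfl
    have h3 : ∀ (a b c : G) (ea : 𝓖.s c = 𝓖.r a) (eb : 𝓖.s c = 𝓖.r b), a = b →
        𝓖.mul c a ea = 𝓖.mul c b eb := by rintro a b c ea eb rfl; rfl
    rw [h2 _ (𝓖.unit (𝓖.r g)) g _ (𝓖.s_unit _) ((𝓖.inv_mul g).trans (by rw [e])),
      𝓖.unit_mul, h3 _ g (𝓖.inv g) _ (𝓖.s_inv g) h, 𝓖.inv_mul, e] at h1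
    exact h1
  exact key _ _ (φ.mul_eq i i i)

/-- `φ ↦ φ ∘ (f × f)`. -/
def map {m : ℕ} (f : Fin (m + 1) →o Fin (n + 1)) (φ : 𝓖.Nerve n) : 𝓖.Nerve m :=
  ⟨fun i j => φ.1 (f i) (f j),
    ⟨fun i j k => (φ.s_eq (f i) (f j)).trans (φ.r_eq (f j) (f k)).symm,
      fun i j k => φ.mul_eq (f i) (f j) (f k)⟩⟩

end Nerve

end TopGroupoid

/-! ### Real simplicial spaces, abelian Real presheaves and Real open covers -/

/-- A Real simplicial space: `map f` is the face/degeneracy map attached to the nondecreasing map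
`f : [m] → [n]`, and `rho n` is the involution in degree `n`. -/
structure RealSimplicialSpace where
  obj : ℕ → Type u
  [top : ∀ n, TopologicalSpace (obj n)]
  map : ∀ {m n : ℕ}, (Fin (m + 1) →o Fin (n + 1)) → obj n → obj m
  continuous_map : ∀ {m n : ℕ} (f : Fin (m + 1) →o Fin (n + 1)), Continuous (map f)
  map_id : ∀ {n : ℕ} (x : obj n), map OrderHom.id x = x
  map_comp : ∀ {k m n : ℕ} (g : Fin (m + 1) →o Fin (n + 1)) (f : Fin (k + 1) →o Fin (m + 1))
    (x : obj n), map (g.comp f) x = map f (map g x)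
  rho : ∀ n, obj n → obj n
  continuous_rho : ∀ n, Continuous (rho n)
  rho_rho : ∀ n (x : obj n), rho n (rho n x) = x
  map_rho : ∀ {m n : ℕ} (f : Fin (m + 1) →o Fin (n + 1)) (x : obj n),
    map f (rho n x) = rho m (map f x)

attribute [instance] RealSimplicialSpace.top

/-- The Real simplicial space `(G_n, ρ_n)` of a Real groupoid. -/
def RealGroupoid.nerve {X : Type u'} {G : Type u} [TopologicalSpace X] [TopologicalSpace G]
    (𝓖 : RealGroupoid X G) : RealSimplicialSpace.{u} where
  obj := 𝓖.toTopGroupoid.Nerve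
  map f φ := φ.map f
  continuous_map f := by
    refine Continuous.subtype_mk ?_ _
    exact continuous_pi fun i => continuous_pi fun j =>
      (continuous_apply (f j)).comp ((continuous_apply (f i)).comp continuous_subtype_val)
  map_id _ := rfl
  map_comp _ _ _ := rfl
  rho n φ := ⟨fun i j => 𝓖.rho (φ.1 i j),
    ⟨fun i j k => by rw [𝓖.s_rho, 𝓖.r_rho, φ.s_eq, φ.r_eq],
      fun i j k => by rw [← 𝓖.rho_mul _ _ ((φ.s_eq i j).trans (φ.r_eq j k).symm), φ.mul_eq]⟩⟩
  continuous_rho n := by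
    refine Continuous.subtype_mk ?_ _
    exact continuous_pi fun i => continuous_pi fun j => 𝓖.continuous_rho.comp
      ((continuous_apply j).comp ((continuous_apply i).comp continuous_subtype_val))
  rho_rho n φ := Subtype.ext (funext fun i => funext fun j => 𝓖.rho_rho _)
  map_rho _ _ := rfl

/-- An abelian Real presheaf on a Real simplicial space: groups of sections `sec n U`, for
`f : [m] → [n]` and open sets with `f̃(U) ⊆ V` a map `f̃^* : sec m V → sec n U` (for `f = id` this is
restriction), and Real structures `sig : sec n U → sec n (ρ_n U)`. -/
structure AbRealPresheaf (X : RealSimplicialSpace.{u}) where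
  sec : ∀ n : ℕ, Opens (X.obj n) → Type v
  [grp : ∀ n U, AddCommGroup (sec n U)]
  pull : ∀ {m n : ℕ} (f : Fin (m + 1) →o Fin (n + 1)) (V : Opens (X.obj m)) (U : Opens (X.obj n)),
    (∀ x ∈ U, X.map f x ∈ V) → (sec m V →+ sec n U)
  pull_id : ∀ {n : ℕ} (U : Opens (X.obj n)) (h : ∀ x ∈ U, X.map OrderHom.id x ∈ U) (c : sec n U),
    pull OrderHom.id U U h c = c
  pull_comp : ∀ {k m n : ℕ} (g : Fin (m + 1) →o Fin (n + 1)) (f : Fin (k + 1) →o Fin (m + 1))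
    (W : Opens (X.obj k)) (V : Opens (X.obj m)) (U : Opens (X.obj n))
    (hf : ∀ x ∈ V, X.map f x ∈ W) (hg : ∀ x ∈ U, X.map g x ∈ V)
    (hgf : ∀ x ∈ U, X.map (g.comp f) x ∈ W) (c : sec k W),
    pull (g.comp f) W U hgf c = pull g V U hg (pull f W V hf c)
  sig : ∀ (n : ℕ) (U U' : Opens (X.obj n)), (∀ x, x ∈ U' ↔ X.rho n x ∈ U) → (sec n U →+ sec n U')
  sig_sig : ∀ (n : ℕ) (U U' : Opens (X.obj n)) (h : ∀ x, x ∈ U' ↔ X.rho n x ∈ U)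
    (h' : ∀ x, x ∈ U ↔ X.rho n x ∈ U') (c : sec n U), sig n U' U h' (sig n U U' h c) = c
  sig_pull : ∀ {m n : ℕ} (f : Fin (m + 1) →o Fin (n + 1)) (V V' : Opens (X.obj m))
    (U U' : Opens (X.obj n)) (hV : ∀ x, x ∈ V' ↔ X.rho m x ∈ V) (hU : ∀ x, x ∈ U' ↔ X.rho n x ∈ U)
    (h : ∀ x ∈ U, X.map f x ∈ V) (h' : ∀ x ∈ U', X.map f x ∈ V') (c : sec m V),
    sig n U U' hU (pull f V U h c) = pull f V' U' h' (sig m V V' hV c)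

attribute [instance] AbRealPresheaf.grp

/-- A Real open cover of a Real simplicial space: in each degree an open cover `(U_j)` indexed by a
set with involution `bar`, such that `U_{bar j} = ρ(U_j)`. -/
structure RealCover (X : RealSimplicialSpace.{u}) where
  J : ℕ → Type u
  bar : ∀ {n : ℕ}, J n → J n
  bar_bar : ∀ {n : ℕ} (j : J n), bar (bar j) = j
  U : ∀ {n : ℕ}, J n → Opens (X.obj n)
  covers : ∀ {n : ℕ} (x : X.obj n), ∃ j : J n, x ∈ U j
  mem_U_bar : ∀ {n : ℕ} (j : J n) (x : X.obj n), x ∈ U (bar j) ↔ X.rho n x ∈ U j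

namespace RealCover

variable {X : RealSimplicialSpace.{u}}

/-- A Real pre-simplicial structure on the index sets, compatible with the cover. -/
structure PreSimplicial (C : RealCover X) where
  face : ∀ {m n : ℕ}, (Fin (m + 1) ↪o Fin (n + 1)) → C.J n → C.J m
  face_id : ∀ {n : ℕ} (j : C.J n), face (RelEmbedding.refl _) j = j
  face_comp : ∀ {k m n : ℕ} (f : Fin (k + 1) ↪o Fin (m + 1)) (g : Fin (m + 1) ↪o Fin (n + 1))
    (j : C.J n), face (f.trans g) j = face f (face g j)
  face_bar : ∀ {m n : ℕ} (f : Fin (m + 1) ↪o Fin (n + 1)) (j : C.J n),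
    face f (C.bar j) = C.bar (face f j)
  map_mem : ∀ {m n : ℕ} (f : Fin (m + 1) ↪o Fin (n + 1)) (j : C.J n) (x : X.obj n),
    x ∈ C.U j → X.map f.toOrderHom x ∈ C.U (face f j)

/-- An `N`-simplicial Real structure on the `N`-skeleton of a Real cover. -/
structure NSimplicial (C : RealCover X) (N : ℕ) where
  str : ∀ {m n : ℕ}, m ≤ N → n ≤ N → (Fin (m + 1) →o Fin (n + 1)) → C.J n → C.J m
  str_id : ∀ {n : ℕ} (hn : n ≤ N) (j : C.J n), str hn hn OrderHom.id j = j
  str_comp : ∀ {k m n : ℕ} (hk : k ≤ N) (hm : m ≤ N) (hn : n ≤ N)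
    (g : Fin (m + 1) →o Fin (n + 1)) (f : Fin (k + 1) →o Fin (m + 1)) (j : C.J n),
    str hk hn (g.comp f) j = str hk hm f (str hm hn g j)
  str_bar : ∀ {m n : ℕ} (hm : m ≤ N) (hn : n ≤ N) (f : Fin (m + 1) →o Fin (n + 1)) (j : C.J n),
    str hm hn f (C.bar j) = C.bar (str hm hn f j)
  map_mem : ∀ {m n : ℕ} (hm : m ≤ N) (hn : n ≤ N) (f : Fin (m + 1) →o Fin (n + 1)) (j : C.J n)
    (x : X.obj n), x ∈ C.U j → X.map f x ∈ C.U (str hm hn f j)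

/-- The pre-simplicial Real cover generated by a Real cover. Its index set in degree `n` consists
of the families `lam` choosing, for every increasing `φ : [k] → [n]`, an index in `J k`, and
`U_lam` is the intersection of the sets `φ̃⁻¹(U_{lam φ})`. (There is no such `φ` for `k > n`.) -/
def natural (C : RealCover X) : RealCover X where
  J n := ∀ k : ℕ, (Fin (k + 1) ↪o Fin (n + 1)) → C.J k
  bar lam := fun k φ => C.bar (lam k φ)
  bar_bar lam := funext fun k => funext fun φ => C.bar_bar _
  U {n} lam :=
    { carrier := {x | ∀ (k : ℕ) (φ : Fin (k + 1) ↪o Fin (n + 1)),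
        X.map φ.toOrderHom x ∈ C.U (lam k φ)}
      is_open' := by
        have h : {x | ∀ (k : ℕ) (φ : Fin (k + 1) ↪o Fin (n + 1)),
            X.map φ.toOrderHom x ∈ C.U (lam k φ)} =
            ⋂ k : Fin (n + 1), ⋂ φ : Fin (k.1 + 1) ↪o Fin (n + 1),
              (X.map φ.toOrderHom) ⁻¹' (C.U (lam k.1 φ) : Set (X.obj k.1)) := by
          ext x
          simp only [Set.mem_ofPred_eq, Set.mem_iInter, Set.mem_preimage, SetLike.mem_coe]
          refine ⟨fun h k φ => h k.1 φ, fun h k φ => ?_⟩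
          have hk : k + 1 ≤ n + 1 := by
            simpa using Fintype.card_le_of_injective φ φ.injective
          exact h ⟨k, hk⟩ φ
        rw [h]
        have : ∀ k : Fin (n + 1), Finite (Fin (k.1 + 1) ↪o Fin (n + 1)) := fun k =>
          Finite.of_injective (fun φ => (φ : Fin (k.1 + 1) → Fin (n + 1))) DFunLike.coe_injective
        exact isOpen_iInter_of_finite fun k => isOpen_iInter_of_finite fun φ =>
          (C.U (lam k.1 φ)).isOpen.preimage (X.continuous_map _) }
  covers {n} x := by
    choose j hj using fun (k : ℕ) (φ : Fin (k + 1) ↪o Fin (n + 1)) =>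
      C.covers (X.map φ.toOrderHom x)
    exact ⟨j, hj⟩
  mem_U_bar {n} lam x := by
    change (∀ (k : ℕ) (φ : Fin (k + 1) ↪o Fin (n + 1)), _) ↔
      ∀ (k : ℕ) (φ : Fin (k + 1) ↪o Fin (n + 1)), _
    refine forall_congr' fun k => forall_congr' fun φ => ?_
    rw [X.map_rho]
    exact C.mem_U_bar _ _

/-- The pre-simplicial structure `(f̃ lam)(φ) = lam (f ∘ φ)`. -/
def naturalPre (C : RealCover X) : C.natural.PreSimplicial where
  face f lam := fun k φ => lam k (φ.trans f)
  face_id _ := rfl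
  face_comp _ _ _ := rfl
  face_bar _ _ := rfl
  map_mem f lam x hx := fun k φ => by
    have h := hx k (φ.trans f)
    have e : X.map (OrderEmbedding.toOrderHom (φ.trans f)) x = X.map φ.toOrderHom (X.map f.toOrderHom x) :=
      X.map_comp f.toOrderHom φ.toOrderHom x
    rwa [e] at h

/-- A refinement exhibiting `D` as finer than `C`: Real maps on index sets with `D_i ⊆ C_{θ i}`. -/
structure Refinement (C D : RealCover X) where
  θ : ∀ {n : ℕ}, D.J n → C.J n
  θ_bar : ∀ {n : ℕ} (i : D.J n), θ (D.bar i) = C.bar (θ i)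
  mem : ∀ {n : ℕ} (i : D.J n) (x : X.obj n), x ∈ D.U i → x ∈ C.U (θ i)

/-- The refinement of generated pre-simplicial covers induced by a refinement. -/
def Refinement.natural {C D : RealCover X} (t : Refinement C D) :
    Refinement C.natural D.natural where
  θ lam := fun k φ => t.θ (lam k φ)
  θ_bar _ := funext fun _ => funext fun _ => t.θ_bar _
  mem _ _ hx := fun k φ => t.mem _ _ (hx k φ)

end RealCover

/-! ### Real Čech cohomology -/

namespace AbRealPresheaf

variable {X : RealSimplicialSpace.{u}} (F : AbRealPresheaf.{u, v} X)

theorem sig_congr {C : RealCover X} {n : ℕ} (c : ∀ j : C.J n, F.sec n (C.U j)) {j j' : C.J n}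
    (e : j = j') (W : Opens (X.obj n)) (h : ∀ x, x ∈ W ↔ X.rho n x ∈ C.U j)
    (h' : ∀ x, x ∈ W ↔ X.rho n x ∈ C.U j') :
    F.sig n _ W h (c j) = F.sig n _ W h' (c j') := by
  subst e; rfl

theorem pull_congr {C : RealCover X} {m n : ℕ} (f : Fin (m + 1) →o Fin (n + 1))
    (c : ∀ j : C.J m, F.sec m (C.U j)) {j j' : C.J m}
    (e : j = j') (W : Opens (X.obj n)) (h : ∀ x ∈ W, X.map f x ∈ C.U j)
    (h' : ∀ x ∈ W, X.map f x ∈ C.U j') :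
    F.pull f _ W h (c j) = F.pull f _ W h' (c j') := by
  subst e; rfl

/-- The group `CR_ss^n` of Real `n`-cochains: globally Real families `(c_j)`. -/
def cochains (C : RealCover X) (n : ℕ) : AddSubgroup (∀ j : C.J n, F.sec n (C.U j)) where
  carrier := {c | ∀ j, c (C.bar j) = F.sig n (C.U j) (C.U (C.bar j)) (C.mem_U_bar j) (c j)}
  zero_mem' j := by simp
  add_mem' {a b} ha hb j := by
    simp only [Pi.add_apply, map_add]
    rw [ha j, hb j]
  neg_mem' {a} ha j := by
    simp only [Pi.neg_apply, map_neg]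
    rw [ha j]

variable {C D : RealCover X}

/-- The differential `(dc)_j = ∑_k (-1)^k ε̃_k^* c_{ε̃_k j}`, where `ε_k : [n] → [n+1]` is the
increasing map that avoids `k`. -/
def d (P : C.PreSimplicial) (n : ℕ) : F.cochains C n →+ F.cochains C (n + 1) where
  toFun c := ⟨fun j => ∑ k : Fin (n + 2), (-1 : ℤ) ^ (k : ℕ) •
      F.pull (Fin.succAboveOrderEmb k).toOrderHom (C.U (P.face (Fin.succAboveOrderEmb k) j)) (C.U j)
        (P.map_mem (Fin.succAboveOrderEmb k) j) (c.1 (P.face (Fin.succAboveOrderEmb k) j)), by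
    intro j
    simp only [map_sum, map_zsmul]
    refine Finset.sum_congr rfl fun k _ => ?_
    congr 1
    rw [F.sig_pull _ _ (C.U (C.bar (P.face (Fin.succAboveOrderEmb k) j))) _ _
      (C.mem_U_bar _) _ _ (fun x hx => by
        have h := P.map_mem (Fin.succAboveOrderEmb k) _ x hx
        rwa [P.face_bar] at h), ← c.2]
    exact F.pull_congr _ c.1 (P.face_bar _ _) _ _ _⟩
  map_zero' := by
    ext j
    simp
  map_add' a b := by
    apply Subtype.ext
    funext j
    simp [Finset.sum_add_distrib]

/-- Real cocycles. -/
def cocycles (P : C.PreSimplicial) (n : ℕ) : AddSubgroup (F.cochains C n) := (F.d P n).ker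

/-- Real coboundaries (zero in degree `0`). -/
def coboundaries (P : C.PreSimplicial) : ∀ n : ℕ, AddSubgroup (F.cochains C n)
  | 0 => ⊥
  | n + 1 => (F.d P n).range

/-- The cohomology group `HR_ss^n` of a pre-simplicial Real cover. -/
abbrev HRss (P : C.PreSimplicial) (n : ℕ) : Type (max u v) :=
  F.cocycles P n ⧸ (F.coboundaries P n).addSubgroupOf (F.cocycles P n)

/-- `(θ^* c)_i` is the restriction of `c_{θ i}`. -/
def refineCochains (t : RealCover.Refinement C D) (n : ℕ) : F.cochains C n →+ F.cochains D n where
  toFun c := ⟨fun i => F.pull OrderHom.id (C.U (t.θ i)) (D.U i)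
      (fun x hx => by rw [X.map_id]; exact t.mem i x hx) (c.1 (t.θ i)), by
    intro i
    rw [F.sig_pull _ _ (C.U (C.bar (t.θ i))) _ _ (C.mem_U_bar _) _ _ (fun x hx => by
        have h := t.mem _ x hx
        rw [t.θ_bar] at h
        rwa [X.map_id]), ← c.2]
    exact F.pull_congr _ c.1 (t.θ_bar _) _ _ _⟩
  map_zero' := by
    ext i
    simp
  map_add' a b := by
    apply Subtype.ext
    funext i
    simp

theorem d_refineCochains (P : C.PreSimplicial) (Q : D.PreSimplicial)
    (t : RealCover.Refinement C D)
    (ht : ∀ {m n : ℕ} (f : Fin (m + 1) ↪o Fin (n + 1)) (i : D.J n),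
      t.θ (Q.face f i) = P.face f (t.θ i)) (n : ℕ) (c : F.cochains C n) :
    F.d Q n (F.refineCochains t n c) = F.refineCochains t (n + 1) (F.d P n c) := by
  apply Subtype.ext
  funext i
  simp only [d, refineCochains, AddMonoidHom.coe_mk, ZeroHom.coe_mk, map_sum, map_zsmul]
  refine Finset.sum_congr rfl fun k _ => ?_
  congr 1
  rw [← F.pull_comp _ _ _ _ _ _ _ (fun x hx => t.mem _ _ (Q.map_mem _ i x hx)),
    ← F.pull_comp _ _ _ _ _ _ _ (fun x hx => P.map_mem _ _ x (t.mem i x hx))]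
  exact F.pull_congr _ c.1 (ht _ _) _ _ _

/-- The map induced on cohomology by a refinement compatible with the face maps. -/
def refineHRss (P : C.PreSimplicial) (Q : D.PreSimplicial) (t : RealCover.Refinement C D)
    (ht : ∀ {m n : ℕ} (f : Fin (m + 1) ↪o Fin (n + 1)) (i : D.J n),
      t.θ (Q.face f i) = P.face f (t.θ i)) (n : ℕ) : F.HRss P n →+ F.HRss Q n :=
  QuotientAddGroup.map _ _
    (((F.refineCochains t n).comp (F.cocycles P n).subtype).codRestrict (F.cocycles Q n)
      (fun c => by
        change F.d Q n (F.refineCochains t n c.1) = 0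
        rw [F.d_refineCochains P Q t ht, show F.d P n c.1 = 0 from c.2, map_zero]))
    (by
      rintro ⟨c, hc⟩ h
      rw [AddSubgroup.mem_addSubgroupOf] at h
      rw [AddSubgroup.mem_comap, AddSubgroup.mem_addSubgroupOf]
      change c ∈ F.coboundaries P n at h
      change F.refineCochains t n c ∈ F.coboundaries Q n
      cases n with
      | zero =>
        have h0 : c = 0 := h
        rw [h0, map_zero]
        exact zero_mem _
      | succ n =>
        obtain ⟨b, rfl⟩ := h
        exact ⟨F.refineCochains t n b, F.d_refineCochains P Q t ht n b⟩)

/-- The Real cohomology group `HR^n` of an arbitrary Real cover. -/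
abbrev HR (C : RealCover X) (n : ℕ) : Type (max u v) := F.HRss C.naturalPre n

/-- The map `θ^*` on Real cohomology induced by a refinement. -/
def refineHR (t : RealCover.Refinement C D) (n : ℕ) : F.HR C n →+ F.HR D n :=
  F.refineHRss C.naturalPre D.naturalPre t.natural (fun _ _ => rfl) n

/-- The collection `𝔑(n)` of Real covers whose `N`-skeleton is `N`-simplicial for some
`N ≥ n + 1`. -/
def CechIndex (X : RealSimplicialSpace.{u}) (n : ℕ) : Type (u + 1) :=
  {C : RealCover X // ∃ N, n + 1 ≤ N ∧ Nonempty (C.NSimplicial N)}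

open Classical in
/-- The relations `[θ^* a] = [a]` of the direct limit over `𝔑(n)`. -/
def cechRelations (n : ℕ) : AddSubgroup (DirectSum (CechIndex X n) fun C => F.HR C.1 n) :=
  AddSubgroup.closure {y | ∃ (C D : CechIndex X n) (t : RealCover.Refinement C.1 D.1)
    (a : F.HR C.1 n),
    y = DirectSum.of (fun C : CechIndex X n => F.HR C.1 n) D (F.refineHR t n a) -
      DirectSum.of (fun C : CechIndex X n => F.HR C.1 n) C a}

/-- The Real Čech cohomology group: the direct limit of the groups `HR^n` over `𝔑(n)`. -/
abbrev CechHR (n : ℕ) : Type (max (u + 1) v) :=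
  (DirectSum (CechIndex X n) fun C => F.HR C.1 n) ⧸ F.cechRelations n

end AbRealPresheaf

/-! ### Real representations -/

/-- A Real representation of rank `k`: a locally trivial Real `𝕂`-vector bundle `(E, ν)` over
`(X, ρ)` with a continuous Real action of the groupoid which is linear on fibres. Here
`bar : 𝕂 → 𝕂` is the Real structure of the additive group `𝕂`. To avoid transports,
`nu` and `act` take the proofs that their points match as arguments. The maps `nu` on fibres are
semilinear for the conjugation of `𝕂` (antilinear for `𝕂 = ℂ` and linear for `𝕂 = ℝ`). -/
structure RealRep {X : Type u'} {G : Type u} [TopologicalSpace X] [TopologicalSpace G]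
    (𝓖 : RealGroupoid X G) (𝕂 : Type) [RCLike 𝕂] (bar : 𝕂 → 𝕂) (k : ℕ) where
  E : X → Type v
  [grp : ∀ x, AddCommGroup (E x)]
  [mod : ∀ x, Module 𝕂 (E x)]
  [top : TopologicalSpace (Bundle.TotalSpace (Fin k → 𝕂) E)]
  nu : ∀ {x y : X}, 𝓖.rhoX x = y → (E x →ₛₗ[starRingEnd 𝕂] E y)
  nu_nu : ∀ {x y : X} (h : 𝓖.rhoX x = y) (h' : 𝓖.rhoX y = x) (ξ : E x), nu h' (nu h ξ) = ξ
  continuous_nu : Continuous fun ξ : Bundle.TotalSpace (Fin k → 𝕂) E =>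
    (⟨𝓖.rhoX ξ.1, nu rfl ξ.2⟩ : Bundle.TotalSpace (Fin k → 𝕂) E)
  act : ∀ (g : G) {x y : X}, 𝓖.s g = x → 𝓖.r g = y → (E x →ₗ[𝕂] E y)
  act_unit : ∀ {x : X} (ξ : E x), act (𝓖.unit x) (𝓖.s_unit x) (𝓖.r_unit x) ξ = ξ
  act_mul : ∀ (g h : G) (e : 𝓖.s g = 𝓖.r h) {x y z : X} (hx : 𝓖.s h = x) (hy : 𝓖.r h = y)
    (hz : 𝓖.r g = z) (ξ : E x),
    act (𝓖.mul g h e) ((𝓖.s_mul g h e).trans hx) ((𝓖.r_mul g h e).trans hz) ξ =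
      act g (e.trans hy) hz (act h hx hy ξ)
  continuous_act : Continuous
    fun p : {p : G × Bundle.TotalSpace (Fin k → 𝕂) E // 𝓖.s p.1 = p.2.1} =>
      (⟨𝓖.r p.1.1, act p.1.1 p.2 rfl p.1.2.2⟩ : Bundle.TotalSpace (Fin k → 𝕂) E)
  nu_act : ∀ (g : G) {x y x' y' : X} (hx : 𝓖.s g = x) (hy : 𝓖.r g = y) (hx' : 𝓖.rhoX x = x')
    (hy' : 𝓖.rhoX y = y') (ξ : E x),
    nu hy' (act g hx hy ξ) =
      act (𝓖.rho g) ((𝓖.s_rho g).trans ((congrArg 𝓖.rhoX hx).trans hx'))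
        ((𝓖.r_rho g).trans ((congrArg 𝓖.rhoX hy).trans hy')) (nu hx' ξ)
  ι : Type u'
  ιbar : ι → ι
  ιbar_ιbar : ∀ j, ιbar (ιbar j) = j
  triv : ι → Bundle.Trivialization (Fin k → 𝕂)
    (Bundle.TotalSpace.proj : Bundle.TotalSpace (Fin k → 𝕂) E → X)
  triv_linear : ∀ j, (triv j).IsLinear 𝕂
  triv_covers : ∀ x, ∃ j, x ∈ (triv j).baseSet
  mem_baseSet_bar : ∀ j x, x ∈ (triv (ιbar j)).baseSet ↔ 𝓖.rhoX x ∈ (triv j).baseSet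
  triv_real : ∀ (j : ι) (x : X) (ξ : E x), x ∈ (triv j).baseSet →
    (triv (ιbar j) ⟨𝓖.rhoX x, nu rfl ξ⟩).2 = fun i => bar ((triv j ⟨x, ξ⟩).2 i)

namespace RealRep

variable {X : Type u'} {G : Type u} [TopologicalSpace X] [TopologicalSpace G]
  {𝓖 : RealGroupoid X G} {𝕂 : Type} [RCLike 𝕂] {bar : 𝕂 → 𝕂} {k : ℕ}

attribute [instance] RealRep.grp RealRep.mod RealRep.top

/-- The total space of the bundle. -/
abbrev Tot (R : RealRep.{u, u', v} 𝓖 𝕂 bar k) : Type (max u' v) :=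
  Bundle.TotalSpace (Fin k → 𝕂) R.E

theorem continuous_zero_section (R : RealRep.{u, u', v} 𝓖 𝕂 bar k) {Y : Type u}
    [TopologicalSpace Y] {p : Y → X} (hp : Continuous p) :
    Continuous fun y => (⟨p y, 0⟩ : R.Tot) := by
  rw [continuous_iff_continuousAt]
  intro y
  obtain ⟨j, hj⟩ := R.triv_covers (p y)
  have := R.triv_linear j
  have hsrc : (⟨p y, 0⟩ : R.Tot) ∈ (R.triv j).source := (R.triv j).mem_source.2 hj
  refine ((R.triv j).tendsto_nhds_iff hsrc).2 ⟨hp.continuousAt, ?_⟩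
  have hev : ∀ᶠ y' in nhds y, p y' ∈ (R.triv j).baseSet :=
    hp.continuousAt.eventually ((R.triv j).open_baseSet.mem_nhds hj)
  refine (tendsto_const_nhds (x := (0 : Fin k → 𝕂))).congr' ?_ |>.trans ?_
  · filter_upwards [hev] with y' hy'
    exact (((R.triv j).linear 𝕂 hy').map_zero).symm
  · rw [((R.triv j).linear 𝕂 hj).map_zero]

theorem continuous_combine (R : RealRep.{u, u', v} 𝓖 𝕂 bar k) {Y : Type u} [TopologicalSpace Y]
    {p : Y → X} (hp : Continuous p) (a b : ∀ y, R.E (p y)) (m : 𝕂)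
    (ha : Continuous fun y => (⟨p y, a y⟩ : R.Tot))
    (hb : Continuous fun y => (⟨p y, b y⟩ : R.Tot)) :
    Continuous fun y => (⟨p y, a y + m • b y⟩ : R.Tot) := by
  rw [continuous_iff_continuousAt]
  intro y
  obtain ⟨j, hj⟩ := R.triv_covers (p y)
  have := R.triv_linear j
  have hsrc : ∀ ξ : R.E (p y), (⟨p y, ξ⟩ : R.Tot) ∈ (R.triv j).source :=
    fun ξ => (R.triv j).mem_source.2 hj
  have hev : ∀ᶠ y' in nhds y, p y' ∈ (R.triv j).baseSet :=
    hp.continuousAt.eventually ((R.triv j).open_baseSet.mem_nhds hj)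
  have ha2 := (((R.triv j).tendsto_nhds_iff (hsrc _)).1 ha.continuousAt).2
  have hb2 := (((R.triv j).tendsto_nhds_iff (hsrc _)).1 hb.continuousAt).2
  refine ((R.triv j).tendsto_nhds_iff (hsrc _)).2 ⟨hp.continuousAt, ?_⟩
  have e := fun (y' : Y) (hy' : p y' ∈ (R.triv j).baseSet) =>
    (((R.triv j).linear 𝕂 hy').map_add (a y') (m • b y')).trans
      (congrArg _ (((R.triv j).linear 𝕂 hy').map_smul m (b y')))
  rw [e y hj]
  refine (ha2.add (hb2.const_smul m)).congr' ?_
  filter_upwards [hev] with y' hy'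
  exact (e y' hy').symm

theorem continuous_vert {n : ℕ} (i : Fin (n + 1)) :
    Continuous fun φ : 𝓖.toTopGroupoid.Nerve n => φ.vert i :=
  𝓖.continuous_r.comp ((continuous_apply i).comp
    ((continuous_apply i).comp continuous_subtype_val))

/-- The group of continuous sections over `U ⊆ G_n` of the pullback of `E` along the last vertex
`(g_1, …, g_n) ↦ s(g_n)`. -/
def sections (R : RealRep.{u, u', v} 𝓖 𝕂 bar k) (n : ℕ)
    (U : Opens (𝓖.toTopGroupoid.Nerve n)) :
    AddSubgroup (∀ φ : U, R.E (φ.1.vert (Fin.last n))) where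
  carrier := {c | Continuous fun φ : U => (⟨φ.1.vert (Fin.last n), c φ⟩ : R.Tot)}
  zero_mem' := R.continuous_zero_section ((continuous_vert _).comp continuous_subtype_val)
  add_mem' {a b} ha hb := by
    have h := R.continuous_combine ((continuous_vert _).comp continuous_subtype_val) a b 1 ha hb
    simpa using h
  neg_mem' {a} ha := by
    have h := R.continuous_combine ((continuous_vert _).comp continuous_subtype_val)
      (fun _ => 0) a (-1)
      (R.continuous_zero_section ((continuous_vert _).comp continuous_subtype_val)) ha
    simpa using h

theorem act_congr (R : RealRep.{u, u', v} 𝓖 𝕂 bar k) {g g' : G} (e : g = g') {x y : X}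
    (hx : 𝓖.s g = x) (hy : 𝓖.r g = y) (hx' : 𝓖.s g' = x) (hy' : 𝓖.r g' = y) (ξ : R.E x) :
    R.act g hx hy ξ = R.act g' hx' hy' ξ := by
  subst e; rfl

theorem tot_act (R : RealRep.{u, u', v} 𝓖 𝕂 bar k) (g : G) {x y : X} (hx : 𝓖.s g = x)
    (hy : 𝓖.r g = y) (ξ : R.E x) :
    (⟨y, R.act g hx hy ξ⟩ : R.Tot) = ⟨𝓖.r g, R.act g hx rfl ξ⟩ := by
  subst hy; rfl

theorem tot_nu (R : RealRep.{u, u', v} 𝓖 𝕂 bar k) {x y : X} (h : 𝓖.rhoX x = y) (ξ : R.E x) :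
    (⟨y, R.nu h ξ⟩ : R.Tot) = ⟨𝓖.rhoX x, R.nu rfl ξ⟩ := by
  subst h; rfl

theorem vert_rho {n : ℕ} (φ : 𝓖.toTopGroupoid.Nerve n) (i : Fin (n + 1)) :
    𝓖.rhoX (TopGroupoid.Nerve.vert (𝓖.nerve.rho n φ) i) = φ.vert i := by
  change 𝓖.rhoX (𝓖.r (𝓖.rho (φ.1 i i))) = 𝓖.r (φ.1 i i)
  rw [𝓖.r_rho, 𝓖.rhoX_rhoX]

/-- `(f̃^* c)(φ) = φ(n, f(m)) · c(f̃ φ)` for `f : [m] → [n]`. -/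
def pullSection (R : RealRep.{u, u', v} 𝓖 𝕂 bar k) {m n : ℕ} (f : Fin (m + 1) →o Fin (n + 1))
    (V : Opens (𝓖.toTopGroupoid.Nerve m)) (U : Opens (𝓖.toTopGroupoid.Nerve n))
    (h : ∀ φ ∈ U, φ.map f ∈ V) : R.sections m V →+ R.sections n U where
  toFun c := ⟨fun φ => R.act (φ.1.1 (Fin.last n) (f (Fin.last m)))
      (φ.1.s_eq _ _) (φ.1.r_eq _ _) (c.1 ⟨φ.1.map f, h φ.1 φ.2⟩), by
    have hmap : Continuous fun φ : U => (⟨φ.1.map f, h φ.1 φ.2⟩ : V) :=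
      Continuous.subtype_mk ((𝓖.nerve.continuous_map f).comp continuous_subtype_val) _
    have hc := (show Continuous _ from c.2).comp hmap
    have hg : Continuous fun φ : U => φ.1.1 (Fin.last n) (f (Fin.last m)) :=
      (continuous_apply _).comp ((continuous_apply _).comp
        (continuous_subtype_val.comp continuous_subtype_val))
    refine (R.continuous_act.comp (Continuous.subtype_mk (hg.prodMk hc)
      (fun φ => φ.1.s_eq _ _))).congr fun φ => ?_
    exact (R.tot_act _ _ _ _).symm⟩
  map_zero' := Subtype.ext (funext fun φ => map_zero _)
  map_add' a b := Subtype.ext (funext fun φ => map_add _ _ _)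

/-- `(σ c)(φ) = ν(c(ρ φ))`. -/
def sigSection (R : RealRep.{u, u', v} 𝓖 𝕂 bar k) (n : ℕ)
    (U U' : Opens (𝓖.toTopGroupoid.Nerve n))
    (h : ∀ φ, φ ∈ U' ↔ 𝓖.nerve.rho n φ ∈ U) : R.sections n U →+ R.sections n U' where
  toFun c := ⟨fun φ => R.nu (vert_rho φ.1 _) (c.1 ⟨𝓖.nerve.rho n φ.1, (h φ.1).1 φ.2⟩), by
    have hmap : Continuous fun φ : U' => (⟨𝓖.nerve.rho n φ.1, (h φ.1).1 φ.2⟩ : U) :=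
      Continuous.subtype_mk ((𝓖.nerve.continuous_rho n).comp continuous_subtype_val) _
    have hc := (show Continuous _ from c.2).comp hmap
    refine (R.continuous_nu.comp hc).congr fun φ => ?_
    exact (R.tot_nu _ _).symm⟩
  map_zero' := Subtype.ext (funext fun φ => map_zero _)
  map_add' a b := Subtype.ext (funext fun φ => map_add _ _ _)

/-- The abelian Real sheaf `(E^•, ν^•)` on `(G_•, ρ_•)` attached to a Real representation. -/
def sheaf (R : RealRep.{u, u', v} 𝓖 𝕂 bar k) : AbRealPresheaf.{u, max u v} 𝓖.nerve where
  sec n U := R.sections n U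
  grp n U := AddSubgroup.toAddCommGroup (R.sections n U)
  pull f V U h := R.pullSection f V U h
  pull_id {n} U h c := by
    refine Subtype.ext (funext fun φ => ?_)
    exact (R.act_congr (TopGroupoid.Nerve.diag_eq φ.1 (Fin.last n)) _ _ (𝓖.s_unit _)
      (𝓖.r_unit _) _).trans (R.act_unit _)
  pull_comp {k m n} g f W V U hf hg hgf c := by
    refine Subtype.ext (funext fun φ => ?_)
    have h := R.act_mul _ _ ((TopGroupoid.Nerve.s_eq φ.1 (Fin.last n) (g (Fin.last m))).trans
      (TopGroupoid.Nerve.r_eq φ.1 (g (Fin.last m)) (g (f (Fin.last k)))).symm)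
      (TopGroupoid.Nerve.s_eq φ.1 _ _) (TopGroupoid.Nerve.r_eq φ.1 _ _)
      (TopGroupoid.Nerve.r_eq φ.1 _ _) (c.1 ⟨𝓖.nerve.map (g.comp f) φ.1, hgf φ.1 φ.2⟩)
    refine Eq.trans ?_ h
    exact R.act_congr (TopGroupoid.Nerve.mul_eq φ.1 _ _ _).symm _ _ _ _ _
  sig n U U' h := R.sigSection n U U' h
  sig_sig n U U' h h' c := by
    refine Subtype.ext (funext fun φ => ?_)
    have key : ∀ (a : U) (ha : a = φ) (e : 𝓖.rhoX (𝓖.rhoX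
        (TopGroupoid.Nerve.vert φ.1 (Fin.last n))) = TopGroupoid.Nerve.vert φ.1 (Fin.last n))
        (x : X) (h1 : 𝓖.rhoX (TopGroupoid.Nerve.vert a.1 (Fin.last n)) = x)
        (h2 : 𝓖.rhoX x = TopGroupoid.Nerve.vert φ.1 (Fin.last n)),
        R.nu h2 (R.nu h1 (c.1 a)) = c.1 φ := by
      rintro a rfl e x h1 h2
      exact R.nu_nu h1 h2 _
    exact key ⟨𝓖.nerve.rho n (𝓖.nerve.rho n φ.1), _⟩ (Subtype.ext (𝓖.nerve.rho_rho n φ.1))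
      (𝓖.rhoX_rhoX _) _ _ _
  sig_pull {m n} f V V' U U' hV hU h h' c := by
    refine Subtype.ext (funext fun φ => ?_)
    refine (R.nu_act _ _ _ (vert_rho φ.1 _) _ _).trans ?_
    refine R.act_congr ?_ _ _ _ _ _
    exact 𝓖.rho_rho _

end RealRep

/-! ### Groupoid algebra and cones over simplices -/

namespace TopGroupoid

variable {X : Type u'} {G : Type u} [TopologicalSpace X] [TopologicalSpace G]

section algebra

variable (𝓖 : TopGroupoid X G)

/-! The cochain complex of every single Real cover is exact in positive degrees, before any limit is
taken. The contraction averages over cones. An arrow `γ` ending at the last vertex of an `n`-simplex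
`φ` gives an `(n+1)`-simplex `φ.cone γ`, with the source of `γ` as new initial vertex. The last
vertex is unchanged, so the values of a cochain on `φ.cone γ` stay in the fibre of `E` over the last
vertex of `φ`. Two averages turn these values into a cochain of degree one less.

The first average is over cover indices. The index `m` of `φ` fixes the indices of the faces of the
cone that avoid the new vertex; the other faces are weighted by partitions of unity (`coneWeights`,
`coneSum`). The second average is an integral over `γ` against a Haar measure, weighted by `w (s γ)`
for a cutoff function `w`. Properness and paracompactness of the orbit space provide `w`
(`HaarSystem.exists_cutoff`).

For a cocycle `c`, the identity `dc = 0` on `φ.cone γ` expresses `c m` at `φ`, which is the face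
opposite the new vertex, through the values on the other faces. By `Nerve.map_succ_cone` these are
cones over the faces of `φ`, with `γ` translated to the last vertex of the face. This is
`cocycle_eq_sum`. Integrating it, left invariance absorbs the translations and what remains is the
differential of the contraction (`dFamily_contraction`).

None of the choices needs to respect the involutions. The cutoff is scaled to mass `1/2`, so that
the contraction `b` satisfies `2 db = c`; then `b` plus its conjugate is a Real primitive of the
Real cocycle `c` (`mem_coboundaries_of_dFamily`). -/

theorem mul_congr {a a' b b' : G} (ha : a = a') (hb : b = b') (e : 𝓖.s a = 𝓖.r b)
    (e' : 𝓖.s a' = 𝓖.r b') : 𝓖.mul a b e = 𝓖.mul a' b' e' := by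
  subst ha hb; rfl

theorem mul_unit_of_eq (a : G) {x : X} (e : 𝓖.s a = x) :
    𝓖.mul a (𝓖.unit x) (e.trans (𝓖.r_unit x).symm) = a := by
  subst e; exact 𝓖.mul_unit a

theorem unit_mul_of_eq (a : G) {x : X} (e : 𝓖.r a = x) :
    𝓖.mul (𝓖.unit x) a ((𝓖.s_unit x).trans e.symm) = a := by
  subst e; exact 𝓖.unit_mul a

theorem mul_mul_inv_cancel (a b : G) (e : 𝓖.s a = 𝓖.r b)
    (e' : 𝓖.s (𝓖.mul a b e) = 𝓖.r (𝓖.inv b)) : 𝓖.mul (𝓖.mul a b e) (𝓖.inv b) e' = a :=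
  (𝓖.mul_assoc a b (𝓖.inv b) e (𝓖.r_inv b).symm).trans
    ((𝓖.mul_congr rfl (𝓖.mul_inv b) _ (e.trans (𝓖.r_unit _).symm)).trans (𝓖.mul_unit_of_eq a e))

theorem inv_mul_mul_cancel (a b : G) (e : 𝓖.s a = 𝓖.r b)
    (e' : 𝓖.s (𝓖.inv a) = 𝓖.r (𝓖.mul a b e)) : 𝓖.mul (𝓖.inv a) (𝓖.mul a b e) e' = b :=
  (𝓖.mul_assoc (𝓖.inv a) a b (𝓖.s_inv a) e).symm.trans
    ((𝓖.mul_congr (𝓖.inv_mul a) rfl _ ((𝓖.s_unit _).trans e)).trans (𝓖.unit_mul_of_eq b e.symm))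

theorem mul_inv_mul_cancel (a b : G) (e : 𝓖.s (𝓖.inv a) = 𝓖.r b)
    (e' : 𝓖.s a = 𝓖.r (𝓖.mul (𝓖.inv a) b e)) : 𝓖.mul a (𝓖.mul (𝓖.inv a) b e) e' = b :=
  (𝓖.mul_assoc a (𝓖.inv a) b (𝓖.r_inv a).symm e).symm.trans
    ((𝓖.mul_congr (𝓖.mul_inv a) rfl _ ((𝓖.s_unit _).trans ((𝓖.s_inv a).symm.trans e))).trans
      (𝓖.unit_mul_of_eq b (e.symm.trans (𝓖.s_inv a))))

/-- The arrows with range `x`. -/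
abbrev Fiber (x : X) : Type u := {g : G // 𝓖.r g = x}

theorem isClosed_fiber [T2Space X] (x : X) : IsClosed {g : G | 𝓖.r g = x} :=
  isClosed_eq 𝓖.continuous_r continuous_const

theorem isClosedEmbedding_fiber [T2Space X] (x : X) :
    Topology.IsClosedEmbedding (Subtype.val : 𝓖.Fiber x → G) :=
  (𝓖.isClosed_fiber x).isClosedEmbedding_subtypeVal

theorem continuous_mul_of {Y : Type*} [TopologicalSpace Y] {a b : Y → G} (ha : Continuous a)
    (hb : Continuous b) (e : ∀ y, 𝓖.s (a y) = 𝓖.r (b y)) :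
    Continuous fun y => 𝓖.mul (a y) (b y) (e y) :=
  𝓖.continuous_mul.comp (Continuous.subtype_mk (ha.prodMk hb) e)

/-- Left translation by an arrow from `x` to `y`. -/
def translate (g : G) {x y : X} (hx : 𝓖.s g = x) (hy : 𝓖.r g = y) : 𝓖.Fiber x ≃ₜ 𝓖.Fiber y where
  toFun h := ⟨𝓖.mul g h.1 (hx.trans h.2.symm), (𝓖.r_mul _ _ _).trans hy⟩
  invFun h := ⟨𝓖.mul (𝓖.inv g) h.1 ((𝓖.s_inv g).trans (hy.trans h.2.symm)),
    (𝓖.r_mul _ _ _).trans ((𝓖.r_inv g).trans hx)⟩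
  left_inv _ := Subtype.ext (𝓖.inv_mul_mul_cancel _ _ _ _)
  right_inv _ := Subtype.ext (𝓖.mul_inv_mul_cancel _ _ _ _)
  continuous_toFun := (𝓖.continuous_mul_of continuous_const continuous_subtype_val _).subtype_mk _
  continuous_invFun := (𝓖.continuous_mul_of continuous_const continuous_subtype_val _).subtype_mk _

@[simp] theorem s_translate (g : G) {x y : X} (hx : 𝓖.s g = x) (hy : 𝓖.r g = y)
    (h : 𝓖.Fiber x) : 𝓖.s (𝓖.translate g hx hy h).1 = 𝓖.s h.1 := 𝓖.s_mul _ _ _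

end algebra

/-! ### Cones in the nerve and their faces -/

namespace Nerve

variable {𝓖 : TopGroupoid X G} {n : ℕ}

theorem apply_eq_mul_inv (φ : 𝓖.Nerve n) (i j l : Fin (n + 1)) :
    φ.1 i j = 𝓖.mul (φ.1 i l) (𝓖.inv (φ.1 j l))
      ((φ.s_eq i l).trans ((φ.s_eq j l).symm.trans (𝓖.r_inv _).symm)) := by
  refine Eq.trans ?_ (𝓖.mul_congr (φ.mul_eq i j l) rfl
    ((𝓖.s_mul _ _ _).trans (𝓖.r_inv _).symm) _)
  exact (𝓖.mul_mul_inv_cancel _ _ _ _).symm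

/-- Every entry is `φ i j = φ i l · (φ j l)⁻¹`, so one column carries all the information. -/
theorem ext_of_col {φ ψ : 𝓖.Nerve n} (l : Fin (n + 1)) (h : ∀ i, φ.1 i l = ψ.1 i l) : φ = ψ := by
  refine Subtype.ext (funext fun i => funext fun j => ?_)
  rw [φ.apply_eq_mul_inv i j l, ψ.apply_eq_mul_inv i j l]
  exact 𝓖.mul_congr (h i) (congrArg _ (h j)) _ _

/-- The simplex spanned by arrows with a common source. -/
def ofArrows (a : Fin (n + 1) → G) (x : X) (ha : ∀ i, 𝓖.s (a i) = x) : 𝓖.Nerve n :=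
  ⟨fun i j => 𝓖.mul (a i) (𝓖.inv (a j)) ((ha i).trans ((ha j).symm.trans (𝓖.r_inv _).symm)),
    ⟨fun i j k => by rw [𝓖.s_mul, 𝓖.r_mul, 𝓖.s_inv], fun i j k => by
      have e1 := (ha i).trans ((ha j).symm.trans (𝓖.r_inv (a j)).symm)
      have e2 := (ha j).trans ((ha k).symm.trans (𝓖.r_inv (a k)).symm)
      have e3 : 𝓖.s (𝓖.inv (a j)) = 𝓖.r (𝓖.mul (a j) (𝓖.inv (a k)) e2) := by
        rw [𝓖.s_inv, 𝓖.r_mul]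
      exact (𝓖.mul_assoc _ _ _ e1 e3).trans
        (𝓖.mul_congr rfl (𝓖.inv_mul_mul_cancel _ _ _ _) _ _)⟩⟩

/-- Entries are read off by solving `a i = g · a j` for `g`, so inverses never have to be handled
again. -/
theorem ofArrows_apply (a : Fin (n + 1) → G) (x : X) (ha : ∀ i, 𝓖.s (a i) = x)
    (i j : Fin (n + 1)) (g : G) (e : 𝓖.s g = 𝓖.r (a j)) (h : a i = 𝓖.mul g (a j) e) :
    (ofArrows (𝓖 := 𝓖) a x ha).1 i j = g :=
  (𝓖.mul_congr h rfl _ ((𝓖.s_mul _ _ _).trans (𝓖.r_inv _).symm)).trans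
    (𝓖.mul_mul_inv_cancel _ _ _ _)

theorem continuous_ofArrows {Y : Type*} [TopologicalSpace Y] (a : Y → Fin (n + 1) → G)
    (x : Y → X) (ha : ∀ y i, 𝓖.s (a y i) = x y) (hc : ∀ i, Continuous fun y => a y i) :
    Continuous fun y => ofArrows (𝓖 := 𝓖) (a y) (x y) (ha y) :=
  Continuous.subtype_mk (continuous_pi fun i => continuous_pi fun j =>
    𝓖.continuous_mul_of (hc i) (𝓖.continuous_inv.comp (hc j)) _) _

/-- The arrows from the source of `γ` to that source and to the vertices of `φ`, through `γ`. -/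
def coneArrows (φ : 𝓖.Nerve n) (γ : 𝓖.Fiber (φ.vert (Fin.last n))) : Fin (n + 2) → G :=
  Fin.cons (𝓖.unit (𝓖.s γ.1)) fun i =>
    𝓖.mul (φ.1 i (Fin.last n)) γ.1 ((φ.s_eq _ _).trans γ.2.symm)

theorem s_coneArrows (φ : 𝓖.Nerve n) (γ : 𝓖.Fiber (φ.vert (Fin.last n))) (i : Fin (n + 2)) :
    𝓖.s (φ.coneArrows γ i) = 𝓖.s γ.1 := by
  refine Fin.cases ?_ (fun i => ?_) i
  · exact 𝓖.s_unit _
  · exact 𝓖.s_mul _ _ _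

/-- The simplex obtained from `φ` by adding the source of `γ`, an arrow to the last vertex of `φ`,
as initial vertex. -/
def cone (φ : 𝓖.Nerve n) (γ : 𝓖.Fiber (φ.vert (Fin.last n))) : 𝓖.Nerve (n + 1) :=
  ofArrows (φ.coneArrows γ) (𝓖.s γ.1) (φ.s_coneArrows γ)

theorem cone_succ_succ (φ : 𝓖.Nerve n) (γ : 𝓖.Fiber (φ.vert (Fin.last n))) (i j : Fin (n + 1)) :
    (φ.cone γ).1 i.succ j.succ = φ.1 i j := by
  have e1 := (φ.s_eq j (Fin.last n)).trans γ.2.symm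
  have e2 : 𝓖.s (φ.1 i j) = 𝓖.r (𝓖.mul (φ.1 j (Fin.last n)) γ.1 e1) := by
    rw [𝓖.r_mul, φ.s_eq, φ.r_eq]
  refine ofArrows_apply _ _ _ _ _ _ e2 ?_
  exact (𝓖.mul_congr (φ.mul_eq i j _).symm rfl _ ((𝓖.s_mul _ _ _).trans e1)).trans
    (𝓖.mul_assoc _ _ _ _ _)

theorem cone_succ_zero (φ : 𝓖.Nerve n) (γ : 𝓖.Fiber (φ.vert (Fin.last n))) (i : Fin (n + 1)) :
    (φ.cone γ).1 i.succ 0 = 𝓖.mul (φ.1 i (Fin.last n)) γ.1 ((φ.s_eq _ _).trans γ.2.symm) :=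
  ofArrows_apply _ _ _ _ _ _ ((𝓖.s_mul _ _ _).trans (𝓖.r_unit _).symm)
    (𝓖.mul_unit_of_eq _ (𝓖.s_mul _ _ _)).symm

theorem cone_last_zero (φ : 𝓖.Nerve n) (γ : 𝓖.Fiber (φ.vert (Fin.last n))) :
    (φ.cone γ).1 (Fin.last (n + 1)) 0 = γ.1 :=
  (φ.cone_succ_zero γ (Fin.last n)).trans
    ((𝓖.mul_congr (φ.diag_eq _) rfl _ ((𝓖.s_unit _).trans γ.2.symm)).trans
      (𝓖.unit_mul_of_eq _ γ.2))

theorem vert_cone_succ (φ : 𝓖.Nerve n) (γ : 𝓖.Fiber (φ.vert (Fin.last n))) (i : Fin (n + 1)) :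
    (φ.cone γ).vert i.succ = φ.vert i :=
  congrArg 𝓖.r (φ.cone_succ_succ γ i i)

theorem vert_cone_last (φ : 𝓖.Nerve n) (γ : 𝓖.Fiber (φ.vert (Fin.last n))) :
    (φ.cone γ).vert (Fin.last (n + 1)) = φ.vert (Fin.last n) :=
  φ.vert_cone_succ γ (Fin.last n)

theorem map_zero_cone (φ : 𝓖.Nerve n) (γ : 𝓖.Fiber (φ.vert (Fin.last n))) :
    (φ.cone γ).map (Fin.succAboveOrderEmb 0).toOrderHom = φ :=
  Subtype.ext (funext fun i => funext fun j => φ.cone_succ_succ γ i j)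

/-- The column of the initial vertex is obtained by composing the arrow from it to the last vertex
with arrows of the face opposite to it, and one column suffices by `ext_of_col`. -/
theorem ext_cone {φ ψ : 𝓖.Nerve (n + 1)} (h : φ.map (Fin.succAboveOrderEmb 0).toOrderHom =
    ψ.map (Fin.succAboveOrderEmb 0).toOrderHom)
    (h0 : φ.1 (Fin.last (n + 1)) 0 = ψ.1 (Fin.last (n + 1)) 0) : φ = ψ := by
  refine ext_of_col 0 fun i => Fin.cases ?_ (fun i => ?_) i
  · rw [φ.diag_eq, ψ.diag_eq, ← φ.s_eq (Fin.last _), h0, ψ.s_eq]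
  · rw [← φ.mul_eq i.succ (Fin.last (n + 1)) 0, ← ψ.mul_eq i.succ (Fin.last (n + 1)) 0]
    exact 𝓖.mul_congr (congrFun (congrFun (congrArg Subtype.val h) i) (Fin.last n)) h0 _ _

/-- This is the combinatorial core of the contraction. Deleting an old vertex keeps the apex, but
the last vertex may change; then the arrow from the apex must be carried to the new last vertex,
which is what the translation does. If the last vertex survives, the translating arrow is a unit. -/
theorem map_succ_cone (φ : 𝓖.Nerve (n + 1)) (γ : 𝓖.Fiber (φ.vert (Fin.last (n + 1))))
    (i : Fin (n + 2)) :
    (φ.cone γ).map (Fin.succAboveOrderEmb i.succ).toOrderHom =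
      (φ.map (Fin.succAboveOrderEmb i).toOrderHom).cone
        (𝓖.translate (φ.1 (i.succAbove (Fin.last n)) (Fin.last (n + 1))) (φ.s_eq _ _)
          (φ.r_eq _ _) γ) := by
  refine ext_cone ?_ ?_
  · refine Eq.trans ?_ (map_zero_cone _ _).symm
    refine Eq.trans ?_ (congrArg (map (Fin.succAboveOrderEmb i).toOrderHom) (map_zero_cone φ γ))
    refine Subtype.ext (funext fun a => funext fun b => ?_)
    change (φ.cone γ).1 (i.succ.succAbove a.succ) (i.succ.succAbove b.succ) =
      (φ.cone γ).1 (i.succAbove a).succ (i.succAbove b).succ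
    rw [Fin.succ_succAbove_succ, Fin.succ_succAbove_succ]
  · refine Eq.trans ?_ (cone_last_zero _ _).symm
    change (φ.cone γ).1 (i.succ.succAbove (Fin.last n).succ) (i.succ.succAbove 0) = _
    rw [Fin.succ_succAbove_succ, Fin.succ_succAbove_zero]
    exact φ.cone_succ_zero γ _

theorem continuous_apply_apply (i j : Fin (n + 1)) : Continuous fun φ : 𝓖.Nerve n => φ.1 i j :=
  (continuous_apply j).comp ((continuous_apply i).comp continuous_subtype_val)

theorem continuous_vertex (i : Fin (n + 1)) : Continuous fun φ : 𝓖.Nerve n => φ.vert i :=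
  𝓖.continuous_r.comp (continuous_apply_apply i i)

theorem continuous_cone {Y : Type*} [TopologicalSpace Y] {φ : Y → 𝓖.Nerve n} {γ : Y → G}
    (hφ : Continuous φ) (hγ : Continuous γ) (h : ∀ y, 𝓖.r (γ y) = (φ y).vert (Fin.last n)) :
    Continuous fun y => (φ y).cone ⟨γ y, h y⟩ := by
  refine continuous_ofArrows _ _ _ fun i => Fin.cases ?_ (fun i => ?_) i
  · exact 𝓖.continuous_unit.comp (𝓖.continuous_s.comp hγ)
  · exact 𝓖.continuous_mul_of ((continuous_apply_apply i (Fin.last n)).comp hφ) hγ _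

/-- Arrows are the same as `1`-simplices. -/
def homeomorphOne (𝓖 : TopGroupoid X G) : G ≃ₜ 𝓖.Nerve 1 where
  toFun g := ofArrows ![g, 𝓖.unit (𝓖.s g)] (𝓖.s g) (Fin.forall_fin_two.2 ⟨rfl, 𝓖.s_unit _⟩)
  invFun φ := φ.1 0 1
  left_inv g := ofArrows_apply _ _ _ _ _ _ (𝓖.r_unit _).symm (𝓖.mul_unit g).symm
  right_inv φ := by
    refine ext_of_col 1 (Fin.forall_fin_two.2 ⟨?_, ?_⟩)
    · exact ofArrows_apply _ _ _ _ _ _ (𝓖.r_unit _).symm (𝓖.mul_unit _).symm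
    · rw [diag_eq, diag_eq, ← s_eq _ 0, ← φ.s_eq 0]
      refine congrArg (fun g => 𝓖.unit (𝓖.s g)) ?_
      exact ofArrows_apply _ _ _ _ _ _ (𝓖.r_unit _).symm (𝓖.mul_unit _).symm
  continuous_toFun := continuous_ofArrows _ _ _ (Fin.forall_fin_two.2
    ⟨continuous_id, 𝓖.continuous_unit.comp 𝓖.continuous_s⟩)
  continuous_invFun := continuous_apply_apply 0 1

instance [T2Space G] : T2Space (𝓖.Nerve n) :=
  inferInstanceAs (T2Space {φ : Fin (n + 1) → Fin (n + 1) → G //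
    ∃ e : ∀ i j k, 𝓖.s (φ i j) = 𝓖.r (φ j k), ∀ i j k, 𝓖.mul (φ i j) (φ j k) (e i j k) = φ i k})

end Nerve

/-- Paracompact Hausdorff spaces are normal. Normality allows Tietze extension from the closed
fibres of the range map. -/
theorem normalSpace_of_paracompactSpace_nerve_one (𝓖 : TopGroupoid X G) [T2Space G]
    [ParacompactSpace (𝓖.Nerve 1)] : NormalSpace G :=
  (Nerve.homeomorphOne 𝓖).isClosedEmbedding.normalSpace

end TopGroupoid

/-! ### Integration along the fibres of a Haar system -/

namespace TopGroupoid

variable {X : Type u'} {G : Type u} [TopologicalSpace X] [TopologicalSpace G]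
  (𝓖 : TopGroupoid X G)

theorem range_val_fiber (x : X) :
    Set.range (Subtype.val : 𝓖.Fiber x → G) = {γ | 𝓖.r γ = x} := by
  ext γ
  exact ⟨fun ⟨γ', h⟩ => h ▸ γ'.2, fun h => ⟨⟨γ, h⟩, rfl⟩⟩

variable {𝓖} {V : Type*} [NormedAddCommGroup V]

theorem hasCompactSupport_fiber [T2Space X] [T2Space G] {x : X} {f : 𝓖.Fiber x → V} {A : Set G}
    (hA : IsCompact A) (h : ∀ γ : 𝓖.Fiber x, γ.1 ∉ A → f γ = 0) : HasCompactSupport f :=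
  HasCompactSupport.of_support_subset_isCompact ((𝓖.isClosedEmbedding_fiber x).isCompact_preimage hA)
    fun γ hγ => by_contra fun hn => hγ (h γ hn)

/-- Compactly supported functions extend from a fibre to all arrows. -/
theorem exists_extension [NormedSpace ℝ V] [FiniteDimensional ℝ V] [T2Space X] [T2Space G]
    [LocallyCompactSpace G] [NormalSpace G] {x : X}
    {f : 𝓖.Fiber x → V} (hf : Continuous f) (hs : HasCompactSupport f) :
    ∃ f' : G → V, Continuous f' ∧ HasCompactSupport f' ∧ ∀ γ : 𝓖.Fiber x, f' γ.1 = f γ := by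
  have : TietzeExtension V := TietzeExtension.of_tvs ℝ
  obtain ⟨h, hh⟩ := ContinuousMap.exists_extension' (𝓖.isClosedEmbedding_fiber x) ⟨f, hf⟩
  -- A Tietze extension need not have compact support. Multiplying by a bump `χ` that is `1` on the
  -- support of `f` repairs this and keeps the values on the fibre.
  obtain ⟨χ, h1, -, hc, -⟩ := exists_continuous_one_zero_of_isCompact
    (hs.isCompact.image continuous_subtype_val) isClosed_empty (Set.disjoint_empty _)
  refine ⟨fun γ => χ γ • h γ, χ.continuous.smul h.continuous, hc.smul_right, fun γ => ?_⟩
  have hγ : h γ.1 = f γ := congrFun hh γ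
  simp only [hγ]
  by_cases h0 : f γ = 0
  · rw [h0, smul_zero]
  · have := h1 (Set.mem_image_of_mem _ (subset_tsupport _ h0))
    rw [this]; exact one_smul _ _

end TopGroupoid

namespace TopGroupoid.HaarSystem

open Filter Topology

variable {X : Type u'} {G : Type u} [TopologicalSpace X] [TopologicalSpace G]
  [MeasurableSpace G] {𝓖 : TopGroupoid X G} (haar : 𝓖.HaarSystem)

/-- The Haar measure on a fibre of the range map. -/
noncomputable def fiberMeasure (x : X) : Measure (𝓖.Fiber x) := (haar.μ x).comap Subtype.val

/-- A regular measure is concentrated on its support. -/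
theorem mem_fiber_ae (x : X) : ∀ᵐ γ ∂(haar.μ x), γ ∈ {γ : G | 𝓖.r γ = x} := by
  have := haar.regular x
  have h := Measure.support_mem_ae_of_regular (μ := haar.μ x)
  rwa [haar.support_eq] at h

theorem continuous_integral_vector [BorelSpace G] {V : Type*} [NormedAddCommGroup V]
    [NormedSpace ℝ V] [FiniteDimensional ℝ V]
    {f : G → V} (hf : Continuous f)
    (hs : HasCompactSupport f) : Continuous fun x => ∫ γ, f γ ∂(haar.μ x) := by
  have : ProperSpace V := FiniteDimensional.proper_real V
  let e := (Module.finBasis ℝ V).equivFunL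
  rw [← e.comp_continuous_iff]
  refine continuous_pi fun i => ?_
  let L : V →L[ℝ] ℝ := (ContinuousLinearMap.proj (R := ℝ) (φ := fun _ => ℝ) i).comp (e : V →L[ℝ] _)
  refine (haar.continuous_integral (fun γ => L (f γ)) (L.continuous.comp hf)
    (hs.comp_left L.map_zero)).congr fun x => ?_
  have := haar.regular x
  exact L.integral_comp_comm (hf.integrable_of_hasCompactSupport hs)

variable [T2Space X] [BorelSpace G]

theorem measurableEmbedding_fiber (𝓖 : TopGroupoid X G) (x : X) :
    MeasurableEmbedding (Subtype.val : 𝓖.Fiber x → G) :=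
  MeasurableEmbedding.subtype_coe (𝓖.isClosed_fiber x).measurableSet

theorem fiberMeasure_apply (x : X) (A : Set (𝓖.Fiber x)) :
    haar.fiberMeasure x A = haar.μ x (Subtype.val '' A) :=
  (measurableEmbedding_fiber 𝓖 x).comap_apply _ _

theorem integral_fiber {V : Type*} [NormedAddCommGroup V] [NormedSpace ℝ V] (x : X) (f : G → V) :
    ∫ γ, f γ.1 ∂(haar.fiberMeasure x) = ∫ γ, f γ ∂(haar.μ x) := by
  rw [fiberMeasure, ← (measurableEmbedding_fiber 𝓖 x).integral_map,
    (measurableEmbedding_fiber 𝓖 x).map_comap, range_val_fiber,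
    Measure.restrict_eq_self_of_ae_mem (haar.mem_fiber_ae x)]

instance (x : X) : IsFiniteMeasureOnCompacts (haar.fiberMeasure x) where
  lt_top_of_isCompact K hK := by
    have := haar.regular x
    rw [fiberMeasure_apply]
    exact (hK.image continuous_subtype_val).measure_lt_top

/-- The support is the whole fibre, not merely contained in it. This is what makes integrals of
nonzero nonnegative functions strictly positive later. -/
instance (x : X) : (haar.fiberMeasure x).IsOpenPosMeasure where
  open_pos U hU hne := by
    obtain ⟨O, hO, rfl⟩ := isOpen_induced_iff.1 hU
    obtain ⟨γ, hγ⟩ := hne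
    rw [fiberMeasure_apply, Set.image_preimage_eq_inter_range, range_val_fiber]
    have hsupp : γ.1 ∈ (haar.μ x).support := by
      rw [haar.support_eq]; exact γ.2
    have h := (Measure.mem_support_iff_forall γ.1).1 hsupp O (hO.mem_nhds hγ)
    rw [measure_inter_conull']
    · exact h.ne'
    · exact measure_mono_null (Set.sdiff_subset_compl _ _) (haar.mem_fiber_ae x)

variable {V : Type*} [NormedAddCommGroup V] [NormedSpace ℝ V] [FiniteDimensional ℝ V]

theorem integrable_fiber {x : X} {f : 𝓖.Fiber x → V} (hf : Continuous f)
    (hs : HasCompactSupport f) : Integrable f (haar.fiberMeasure x) := by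
  have : ProperSpace V := FiniteDimensional.proper_real V
  exact hf.integrable_of_hasCompactSupport hs

/-- Invariance is postulated for real functions on all of `G`. Extension from the fibre by
`exists_extension` covers real functions on a fibre, and linear functionals reduce vector values to
real ones. -/
theorem integral_translate [T2Space G] [LocallyCompactSpace G] [NormalSpace G] (g : G) {x y : X}
    (hx : 𝓖.s g = x) (hy : 𝓖.r g = y) {f : 𝓖.Fiber y → V} (hf : Continuous f)
    (hs : HasCompactSupport f) :
    ∫ γ, f (𝓖.translate g hx hy γ) ∂(haar.fiberMeasure x) = ∫ γ, f γ ∂(haar.fiberMeasure y) := by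
  have hreal : ∀ {f : 𝓖.Fiber y → ℝ}, Continuous f → HasCompactSupport f →
      ∫ γ, f (𝓖.translate g hx hy γ) ∂(haar.fiberMeasure x) =
        ∫ γ, f γ ∂(haar.fiberMeasure y) := by
    intro f hf hs
    obtain ⟨f', hf', hs', h⟩ := exists_extension hf hs
    subst hx hy
    have key := haar.left_invariant f' hf' hs' g
    rw [← integral_fiber, ← integral_fiber] at key
    simp only [h] at key
    rw [← key]
    refine integral_congr_ae (Eventually.of_forall fun γ => ?_)
    simp only
    rw [dif_pos γ.2.symm, ← h]
    rfl
  have hf2 := hf.comp (𝓖.translate g hx hy).continuous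
  have hs2 := hs.comp_homeomorph (𝓖.translate g hx hy)
  refine (SeparatingDual.eq_iff_forall_dual_eq (R := ℝ)).2 fun L => ?_
  rw [← L.integral_comp_comm (haar.integrable_fiber hf hs)]
  refine (L.integral_comp_comm (haar.integrable_fiber hf2 hs2)).symm.trans ?_
  exact hreal (L.continuous.comp hf) (hs.comp_left L.map_zero)

/-- Fibre integrals of a continuous function with fibrewise compact support, depending
continuously on a parameter. -/
theorem continuous_integral_fiber [T2Space G] [LocallyCompactSpace G] [NormalSpace G]
    {Y : Type*} [TopologicalSpace Y] {p : Y → X} (hp : Continuous p) (F : ∀ y, 𝓖.Fiber (p y) → V)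
    (hF : Continuous fun z : {z : Y × G // 𝓖.r z.2 = p z.1} => F z.1.1 ⟨z.1.2, z.2⟩)
    (hs : ∀ y₀, ∃ A : Set G, IsCompact A ∧ ∀ᶠ y in 𝓝 y₀, ∀ γ : 𝓖.Fiber (p y), γ.1 ∉ A → F y γ = 0) :
    Continuous fun y => ∫ γ, F y γ ∂(haar.fiberMeasure (p y)) := by
  rw [continuous_iff_continuousAt]
  intro y₀
  obtain ⟨A, hA, hFA⟩ := hs y₀
  have hFc : ∀ y, Continuous (F y) := fun y =>
    hF.comp ((continuous_const.prodMk continuous_subtype_val).subtype_mk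
      fun γ : 𝓖.Fiber (p y) => (γ.2 : 𝓖.r ((y, γ.1) : Y × G).2 = p ((y, γ.1) : Y × G).1))
  -- The integrand at `y₀` is extended to a compactly supported function `f` on `G`. Its fibre
  -- integrals vary continuously, so it remains to see that those of `F y - f` tend to `0`.
  obtain ⟨f, hf, hfs, hfF⟩ := exists_extension (hFc y₀) (hasCompactSupport_fiber hA hFA.self_of_nhds)
  obtain ⟨χ, h1, -, hc, hχ⟩ := exists_continuous_one_zero_of_isCompact
    (hA.union hfs) isClosed_empty (Set.disjoint_empty _)
  have hlim : Tendsto (fun y => ∫ γ : 𝓖.Fiber (p y), f γ.1 ∂(haar.fiberMeasure (p y))) (𝓝 y₀)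
      (𝓝 (∫ γ, F y₀ γ ∂(haar.fiberMeasure (p y₀)))) := by
    simp only [← hfF, integral_fiber]
    exact ((haar.continuous_integral_vector hf hfs).comp hp).continuousAt
  have hχlim : Tendsto (fun y => ∫ γ : 𝓖.Fiber (p y), χ γ.1 ∂(haar.fiberMeasure (p y))) (𝓝 y₀)
      (𝓝 (∫ γ : 𝓖.Fiber (p y₀), χ γ.1 ∂(haar.fiberMeasure (p y₀)))) := by
    simp only [integral_fiber]
    exact ((haar.continuous_integral χ χ.continuous hc).comp hp).continuousAt
  -- Near `y₀` the integral of `χ` stays below `M`; it bounds the mass of the compact set off which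
  -- both `F y` and `f` vanish.
  set M := (∫ γ : 𝓖.Fiber (p y₀), χ γ.1 ∂(haar.fiberMeasure (p y₀))) + 1 with hM
  have hM0 : 0 < M := add_pos_of_nonneg_of_pos (integral_nonneg fun γ => (hχ _).1) one_pos
  have hdiff : Tendsto (fun y => (∫ γ, F y γ ∂(haar.fiberMeasure (p y))) -
      ∫ γ : 𝓖.Fiber (p y), f γ.1 ∂(haar.fiberMeasure (p y))) (𝓝 y₀) (𝓝 0) := by
    rw [Metric.tendsto_nhds]
    intro ε hε
    -- Uniformity in `γ` is a tube lemma argument over the compact set. Near a `γ` outside the fibre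
    -- over `p y₀` the condition becomes vacuous.
    have hclose : ∀ᶠ y in 𝓝 y₀, ∀ γ ∈ A ∪ tsupport f, ∀ h : 𝓖.r γ = p y,
        ‖F y ⟨γ, h⟩ - f γ‖ < ε / M / 2 := by
      refine (hA.union hfs).eventually_forall_of_forall_eventually fun γ _ => ?_
      by_cases h : 𝓖.r γ = p y₀
      · have hcont : Continuous fun z : {z : Y × G // 𝓖.r z.2 = p z.1} =>
            ‖F z.1.1 ⟨z.1.2, z.2⟩ - f z.1.2‖ :=
          (hF.sub (hf.comp (continuous_snd.comp continuous_subtype_val))).norm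
        have hev : ∀ᶠ z in 𝓝 (⟨(y₀, γ), h⟩ : {z : Y × G // 𝓖.r z.2 = p z.1}),
            ‖F z.1.1 ⟨z.1.2, z.2⟩ - f z.1.2‖ < ε / M / 2 := by
          refine hcont.continuousAt.eventually (gt_mem_nhds ?_)
          change ‖F y₀ ⟨γ, h⟩ - f γ‖ < _
          rw [← hfF ⟨γ, h⟩, sub_self, norm_zero]
          positivity
        rw [nhds_subtype_eq_comap, eventually_comap] at hev
        filter_upwards [hev] with z hz hr
        exact hz ⟨z, hr⟩ rfl
      · have hev : ∀ᶠ z : Y × G in 𝓝 (y₀, γ), 𝓖.r z.2 ≠ p z.1 :=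
          (isOpen_ne_fun (𝓖.continuous_r.comp continuous_snd)
            (hp.comp continuous_fst)).mem_nhds h
        filter_upwards [hev] with z hz hr
        exact absurd hr hz
    filter_upwards [hclose, hFA, hχlim.eventually (gt_mem_nhds (lt_add_one _))] with y h2 h3 h4
    have hi1 := haar.integrable_fiber (hFc y) (hasCompactSupport_fiber hA h3)
    have hi2 := haar.integrable_fiber (hf.comp continuous_subtype_val)
      (hfs.comp_isClosedEmbedding (𝓖.isClosedEmbedding_fiber (p y)))
    have hi3 := haar.integrable_fiber (χ.continuous.comp continuous_subtype_val)
      (hc.comp_isClosedEmbedding (𝓖.isClosedEmbedding_fiber (p y)))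
    rw [dist_zero_right]
    calc _ = ‖∫ γ, (F y γ - f γ.1) ∂(haar.fiberMeasure (p y))‖ := by
          exact congrArg norm (integral_sub hi1 hi2).symm
      _ ≤ ∫ γ : 𝓖.Fiber (p y), ε / M / 2 * χ γ.1 ∂(haar.fiberMeasure (p y)) := by
          refine norm_integral_le_of_norm_le (hi3.const_mul _) (Eventually.of_forall fun γ => ?_)
          by_cases hγ : γ.1 ∈ A ∪ tsupport f
          · have h5 := h1 hγ
            simp only [Pi.one_apply] at h5
            simpa [h5] using (h2 γ.1 hγ γ.2).le
          · have h5 : f γ.1 = 0 := image_eq_zero_of_notMem_tsupport fun h => hγ (Or.inr h)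
            rw [h3 γ fun h => hγ (Or.inl h), h5, sub_zero, norm_zero]
            have := (hχ γ.1).1
            positivity
      _ = ε / M / 2 * ∫ γ : 𝓖.Fiber (p y), χ γ.1 ∂(haar.fiberMeasure (p y)) :=
          integral_const_mul _ _
      _ ≤ ε / M / 2 * M := by gcongr
      _ < ε := by field_simp; linarith
  simpa [ContinuousAt] using hdiff.add hlim

end TopGroupoid.HaarSystem

/-! ### Cutoff functions of proper groupoids -/

namespace TopGroupoid

open Filter Topology

variable {X : Type u'} {G : Type u} [TopologicalSpace X] [TopologicalSpace G]
  {𝓖 : TopGroupoid X G}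

theorem mk_s_eq_mk_r (𝓖 : TopGroupoid X G) (g : G) :
    (Quotient.mk 𝓖.orbitSetoid (𝓖.s g)) = Quotient.mk 𝓖.orbitSetoid (𝓖.r g) :=
  Quotient.sound ⟨g, rfl, rfl⟩

/-- A bump at `g` supported in `U` has positive integral over the fibre through `g`, hence by
continuity over all nearby fibres, and these must therefore meet `U`. -/
theorem HaarSystem.isOpenMap_r [T2Space G] [LocallyCompactSpace G] [MeasurableSpace G]
    [BorelSpace G] [T2Space X] (haar : 𝓖.HaarSystem) : IsOpenMap 𝓖.r := by
  intro U hU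
  rw [isOpen_iff_mem_nhds]
  rintro _ ⟨g, hg, rfl⟩
  obtain ⟨f, h1, h0, hc, hf⟩ := exists_continuous_one_zero_of_isCompact (isCompact_singleton (x := g))
    hU.isClosed_compl (Set.disjoint_compl_right_iff_subset.2 (Set.singleton_subset_iff.2 hg))
  have hpos : 0 < ∫ γ, f γ ∂(haar.μ (𝓖.r g)) := by
    rw [← haar.integral_fiber]
    refine (f.continuous.comp continuous_subtype_val).integral_pos_of_hasCompactSupport_nonneg_nonzero
      (hc.comp_isClosedEmbedding (𝓖.isClosedEmbedding_fiber _)) (fun γ => (hf γ.1).1)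
      (x := ⟨g, rfl⟩) ?_
    have := h1 rfl
    simp only [Pi.one_apply] at this
    simp [this]
  filter_upwards [(haar.continuous_integral f f.continuous hc).continuousAt.eventually
    (lt_mem_nhds hpos)] with x hx
  by_contra hn
  rw [← haar.integral_fiber] at hx
  refine hx.ne' (integral_eq_zero_of_ae (Eventually.of_forall fun γ => ?_))
  exact h0 fun hγ => hn ⟨γ.1, hγ, γ.2⟩

/-- The saturation of `U` is `r (s⁻¹ U)`, open because the range map is open. -/
theorem HaarSystem.isOpenQuotientMap_orbit [T2Space G] [LocallyCompactSpace G] [MeasurableSpace G]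
    [BorelSpace G] [T2Space X] (haar : 𝓖.HaarSystem) :
    IsOpenQuotientMap (Quotient.mk 𝓖.orbitSetoid) where
  surjective := Quotient.mk_surjective
  continuous := continuous_quotient_mk'
  isOpenMap U hU := by
    change IsOpen (Quotient.mk 𝓖.orbitSetoid ⁻¹' _)
    convert haar.isOpenMap_r _ (hU.preimage 𝓖.continuous_s) using 1
    ext y
    constructor
    · rintro ⟨x, hx, hxy⟩
      obtain ⟨g, rfl, rfl⟩ := Quotient.exact hxy
      exact ⟨g, hx, rfl⟩
    · rintro ⟨g, hg, rfl⟩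
      exact ⟨_, hg, 𝓖.mk_s_eq_mk_r g⟩

/-- The orbit relation is the range of `(s, r)`, which is closed since proper maps are closed; an
open quotient by a closed relation is Hausdorff. -/
theorem HaarSystem.t2Space_orbitSpace [T2Space G] [LocallyCompactSpace G] [MeasurableSpace G]
    [BorelSpace G] [T2Space X] (haar : 𝓖.HaarSystem) (hp : 𝓖.IsProper) :
    T2Space 𝓖.OrbitSpace := by
  rw [t2Space_iff_of_isOpenQuotientMap haar.isOpenQuotientMap_orbit]
  convert hp.isClosedMap.isClosed_range using 1
  ext ⟨x, y⟩
  constructor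
  · intro h
    obtain ⟨g, rfl, rfl⟩ := Quotient.exact h
    exact ⟨g, rfl⟩
  · rintro ⟨g, hg⟩
    obtain ⟨rfl, rfl⟩ := Prod.mk.inj hg
    exact 𝓖.mk_s_eq_mk_r g

/-- The arrows with range in a compact set and source in the support of `w` lie in a compact set. -/
def IsCutoffSupported (𝓖 : TopGroupoid X G) (w : X → ℝ) : Prop :=
  ∀ K : Set X, IsCompact K → ∃ A : Set G, IsCompact A ∧ ∀ γ, 𝓖.r γ ∈ K → w (𝓖.s γ) ≠ 0 → γ ∈ A

theorem IsCutoffSupported.hasCompactSupport [T2Space X] [T2Space G] {w : X → ℝ}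
    (hw : 𝓖.IsCutoffSupported w) {V : Type*} [NormedAddCommGroup V] {x : X} {f : 𝓖.Fiber x → V}
    (hf : ∀ γ, w (𝓖.s γ.1) = 0 → f γ = 0) : HasCompactSupport f := by
  obtain ⟨A, hA, h⟩ := hw {x} isCompact_singleton
  exact hasCompactSupport_fiber hA fun γ hγ => hf γ (by_contra fun hn => hγ (h γ.1 γ.2 hn))

theorem IsCutoffSupported.eventually [LocallyCompactSpace X] {w : X → ℝ}
    (hw : 𝓖.IsCutoffSupported w) {Y : Type*} [TopologicalSpace Y] {p : Y → X} (hp : Continuous p)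
    (y₀ : Y) : ∃ A : Set G, IsCompact A ∧
      ∀ᶠ y in 𝓝 y₀, ∀ γ : 𝓖.Fiber (p y), γ.1 ∉ A → w (𝓖.s γ.1) = 0 := by
  obtain ⟨K, hK, hKn⟩ := exists_compact_mem_nhds (p y₀)
  obtain ⟨A, hA, h⟩ := hw K hK
  refine ⟨A, hA, ?_⟩
  filter_upwards [hp.continuousAt.preimage_mem_nhds hKn] with y hy γ hγ
  exact by_contra fun hn => hγ (h γ.1 (γ.2.symm ▸ hy) hn)

/-- There is a nonnegative function on the units that does not vanish on any orbit. -/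
theorem HaarSystem.exists_supported [T2Space X] [LocallyCompactSpace X] [T2Space G]
    [LocallyCompactSpace G] [MeasurableSpace G] [BorelSpace G] [ParacompactSpace 𝓖.OrbitSpace]
    (haar : 𝓖.HaarSystem) (hp : 𝓖.IsProper) :
    ∃ w : X → ℝ, Continuous w ∧ (∀ x, 0 ≤ w x) ∧ 𝓖.IsCutoffSupported w ∧
      ∀ x, ∃ γ : 𝓖.Fiber x, w (𝓖.s γ.1) ≠ 0 := by
  have hπ := haar.isOpenQuotientMap_orbit
  have := haar.t2Space_orbitSpace hp
  choose f h1 _ hc hf using fun x : X => exists_continuous_one_zero_of_isCompact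
    (isCompact_singleton (x := x)) isClosed_empty (Set.disjoint_empty _)
  -- The images in `X / G` of the sets where the bumps `f x` do not vanish form an open cover.
  -- Pulled back to `X`, a subordinate partition of unity gives orbit-invariant, locally finite
  -- coefficients for the compactly supported bumps.
  obtain ⟨ρ, hρ⟩ := PartitionOfUnity.exists_isSubordinate isClosed_univ
    (fun x => Quotient.mk 𝓖.orbitSetoid '' {y | f x y ≠ 0})
    (fun x => hπ.isOpenMap _ (isOpen_ne_fun (f x).continuous continuous_const))
    (fun q _ => by
      obtain ⟨x, rfl⟩ := Quotient.mk_surjective q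
      refine Set.mem_iUnion.2 ⟨x, x, ?_, rfl⟩
      have := h1 x rfl
      simp only [Pi.one_apply] at this
      simp [this])
  have hfin : LocallyFinite fun x => Function.support fun y => ρ x (Quotient.mk _ y) * f x y :=
    (ρ.locallyFinite.preimage_continuous hπ.continuous).subset fun x y hy => left_ne_zero_of_mul hy
  have hnn : ∀ y x, 0 ≤ ρ x (Quotient.mk _ y) * f x y := fun y x =>
    mul_nonneg (ρ.nonneg _ _) (hf x y).1
  refine ⟨fun y => ∑ᶠ x, ρ x (Quotient.mk _ y) * f x y, ?_, ?_, ?_, ?_⟩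
  · exact continuous_finsum
      (fun x => ((ρ x).continuous.comp hπ.continuous).mul (f x).continuous) hfin
  · exact fun y => finsum_nonneg (hnn y)
  · intro K hK
    -- An arrow with range in `K` has its source in an orbit meeting `K`, so only finitely many
    -- bumps can be nonzero there. Their supports have compact union, and properness makes the set
    -- of arrows from that union to `K` compact.
    have hI := ρ.locallyFinite.finite_nonempty_inter_compact (hK.image hπ.continuous)
    refine ⟨_, hp.isCompact_preimage ((hI.isCompact_biUnion fun x _ => hc x).prod hK), ?_⟩
    intro γ hγ hw
    obtain ⟨x, hx⟩ := not_forall.1 (mt finsum_eq_zero_of_forall_eq_zero hw)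
    refine ⟨Set.mem_biUnion (x := x) ?_ (subset_tsupport _ (right_ne_zero_of_mul hx)), hγ⟩
    exact ⟨_, left_ne_zero_of_mul hx, 𝓖.r γ, hγ, (𝓖.mk_s_eq_mk_r γ).symm⟩
  · intro x
    obtain ⟨i, hi⟩ := ρ.exists_pos (Set.mem_univ (Quotient.mk 𝓖.orbitSetoid x))
    obtain ⟨y, hy, hyx⟩ := hρ i (subset_tsupport _ hi.ne')
    obtain ⟨g, rfl, rfl⟩ := Quotient.exact hyx
    refine ⟨⟨g, rfl⟩, ne_of_gt (lt_of_lt_of_le ?_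
      (single_le_finsum i (hfin.point_finite (𝓖.s g)) (hnn (𝓖.s g))))⟩
    rw [𝓖.mk_s_eq_mk_r]
    exact mul_pos hi (lt_of_le_of_ne (hf i _).1 (Ne.symm hy))

/-- Cutoff functions exist for proper groupoids. -/
theorem HaarSystem.exists_cutoff [T2Space X] [LocallyCompactSpace X] [T2Space G]
    [LocallyCompactSpace G] [NormalSpace G] [MeasurableSpace G] [BorelSpace G]
    [ParacompactSpace 𝓖.OrbitSpace] (haar : 𝓖.HaarSystem) (hp : 𝓖.IsProper) :
    ∃ w : X → ℝ, Continuous w ∧ 𝓖.IsCutoffSupported w ∧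
      ∀ x, ∫ γ, w (𝓖.s γ.1) ∂(haar.fiberMeasure x) = 1 := by
  obtain ⟨w, hw, hnn, hsupp, hne⟩ := haar.exists_supported hp
  have hsc : ∀ x, Continuous fun γ : 𝓖.Fiber x => w (𝓖.s γ.1) := fun x =>
    hw.comp (𝓖.continuous_s.comp continuous_subtype_val)
  have hcs : ∀ x, HasCompactSupport fun γ : 𝓖.Fiber x => w (𝓖.s γ.1) := fun x =>
    hsupp.hasCompactSupport fun _ h => h
  have hIpos : ∀ x, 0 < ∫ γ, w (𝓖.s γ.1) ∂(haar.fiberMeasure x) := fun x => by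
    obtain ⟨γ, hγ⟩ := hne x
    exact (hsc x).integral_pos_of_hasCompactSupport_nonneg_nonzero (hcs x) (fun γ => hnn _) hγ
  have hIcont : Continuous fun x => ∫ γ, w (𝓖.s γ.1) ∂(haar.fiberMeasure x) := by
    refine haar.continuous_integral_fiber continuous_id (fun x γ => w (𝓖.s γ.1)) ?_
      fun x => hsupp.eventually continuous_id x
    exact hw.comp (𝓖.continuous_s.comp (continuous_snd.comp continuous_subtype_val))
  -- Left translation preserves sources, so the total mass is constant on orbits. Hence dividing `w`
  -- by it at `s γ` amounts to dividing by a constant along the fibre over `x`.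
  have hinv : ∀ g, ∫ γ, w (𝓖.s γ.1) ∂(haar.fiberMeasure (𝓖.s g)) =
      ∫ γ, w (𝓖.s γ.1) ∂(haar.fiberMeasure (𝓖.r g)) := fun g => by
    rw [← haar.integral_translate g rfl rfl (hsc _) (hcs _)]
    simp only [s_translate]
  refine ⟨fun x => w x / ∫ γ, w (𝓖.s γ.1) ∂(haar.fiberMeasure x),
    hw.div hIcont fun x => (hIpos x).ne', fun K hK => ?_, fun x => ?_⟩
  · obtain ⟨A, hA, h⟩ := hsupp K hK
    exact ⟨A, hA, fun γ hγ hn => h γ hγ fun h0 => hn (by simp only [h0, zero_div])⟩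
  · simp only [hinv]
    calc _ = ∫ γ, w (𝓖.s γ.1) / (∫ γ, w (𝓖.s γ.1) ∂(haar.fiberMeasure x))
          ∂(haar.fiberMeasure x) := by
          refine integral_congr_ae (Eventually.of_forall fun γ => ?_)
          obtain ⟨γ, rfl⟩ := γ
          rfl
      _ = _ := by rw [integral_div, div_self (hIpos x).ne']

end TopGroupoid

/-! ### Weighted sums over finite products of index sets -/

section expect

variable {A B : Type*} [Fintype A] [Fintype B] {J : A → Type*} {𝕂 : Type*} [Field 𝕂]
  {V W : Type*} [AddCommGroup V] [Module 𝕂 V] [AddCommGroup W] [Module 𝕂 W]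

open Classical in
/-- The weighted sum of `x` over `∏ a, J a` for the product of the weights `q a`. -/
noncomputable def weightedSum (q : ∀ a, J a →₀ 𝕂) (x : (∀ a, J a) → V) : V :=
  ∑ l ∈ Fintype.piFinset fun a => (q a).support, (∏ a, q a (l a)) • x l

open Classical in
theorem weightedSum_eq_sum (q : ∀ a, J a →₀ 𝕂) (x : (∀ a, J a) → V) (T : ∀ a, Finset (J a))
    (hT : ∀ a, (q a).support ⊆ T a) :
    weightedSum q x = ∑ l ∈ Fintype.piFinset T, (∏ a, q a (l a)) • x l := by
  refine Finset.sum_subset (Fintype.piFinset_subset _ _ hT) fun l _ hl => ?_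
  obtain ⟨a, ha⟩ := not_forall.1 (mt Fintype.mem_piFinset.2 hl)
  have h0 : ∏ a, q a (l a) = 0 :=
    Finset.prod_eq_zero (Finset.mem_univ a) (Finsupp.notMem_support_iff.1 ha)
  rw [h0, zero_smul]

theorem weightedSum_congr {q : ∀ a, J a →₀ 𝕂} {x y : (∀ a, J a) → V}
    (h : ∀ l : ∀ a, J a, (∀ a, q a (l a) ≠ 0) → x l = y l) : weightedSum q x = weightedSum q y := by
  classical
  refine Finset.sum_congr rfl fun l hl => ?_
  rw [h l fun a => Finsupp.mem_support_iff.1 (Fintype.mem_piFinset.1 hl a)]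

theorem map_weightedSum (f : V →ₗ[𝕂] W) (q : ∀ a, J a →₀ 𝕂) (x : (∀ a, J a) → V) :
    f (weightedSum q x) = weightedSum q fun l => f (x l) := by
  simp [weightedSum]

theorem weightedSum_zero (q : ∀ a, J a →₀ 𝕂) : (weightedSum q fun _ => (0 : V)) = 0 := by
  simp [weightedSum]

theorem weightedSum_sum {ι : Type*} (s : Finset ι) (q : ∀ a, J a →₀ 𝕂)
    (x : ι → (∀ a, J a) → V) :
    (weightedSum q fun l => ∑ i ∈ s, x i l) = ∑ i ∈ s, weightedSum q (x i) := by
  simp only [weightedSum, Finset.smul_sum]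
  exact Finset.sum_comm

theorem weightedSum_zsmul (n : ℤ) (q : ∀ a, J a →₀ 𝕂) (x : (∀ a, J a) → V) :
    (weightedSum q fun l => n • x l) = n • weightedSum q x := by
  simp only [weightedSum, Finset.smul_sum]
  exact Finset.sum_congr rfl fun l _ => smul_comm _ _ _

theorem weightedSum_single (m : ∀ a, J a) (x : (∀ a, J a) → V) :
    weightedSum (fun a => Finsupp.single (m a) (1 : 𝕂)) x = x m := by
  classical
  rw [weightedSum_eq_sum _ _ (fun a => {m a}) fun a => Finsupp.support_single_subset,
    Fintype.piFinset_singleton, Finset.sum_singleton]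
  simp

/-- Weights of total mass one on unused coordinates can be dropped. -/
theorem weightedSum_comp (f : B → A) (hf : Function.Injective f) (q : ∀ a, J a →₀ 𝕂)
    (hq : ∀ a, ((q a).sum fun _ t => t) = 1) (x : (∀ b, J (f b)) → V) :
    (weightedSum q fun l => x fun b => l (f b)) = weightedSum (fun b => q (f b)) x := by
  classical
  unfold weightedSum
  rw [← Finset.sum_fiberwise_of_maps_to (s := Fintype.piFinset fun a => (q a).support)
    (t := Fintype.piFinset fun b => (q (f b)).support) (g := fun l b => l (f b))
    fun l hl => Fintype.mem_piFinset.2 fun b => Fintype.mem_piFinset.1 hl (f b)]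
  refine Finset.sum_congr rfl fun m hm => ?_
  -- The families restricting to `m` along `f` form a product again: the singleton `{m b}` at `f b`,
  -- the full support at all other coordinates. The latter contribute factors of total mass one.
  let T : ∀ a, Finset (J a) := fun a => (q a).support.filter fun j => ∀ b (h : f b = a), h ▸ m b = j
  have hT : (Fintype.piFinset fun a => (q a).support).filter (fun l => (fun b => l (f b)) = m) =
      Fintype.piFinset T := by
    ext l
    simp only [Finset.mem_filter, Fintype.mem_piFinset, T]
    constructor
    · rintro ⟨h, rfl⟩ a
      refine ⟨h a, ?_⟩
      rintro b rfl
      rfl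
    · exact fun h => ⟨fun a => (h a).1, funext fun b => ((h (f b)).2 b rfl).symm⟩
  have hfb : ∀ b, T (f b) = {m b} := fun b => by
    ext j
    simp only [T, Finset.mem_filter, Finset.mem_singleton]
    constructor
    · exact fun h => (h.2 b rfl).symm
    · rintro rfl
      refine ⟨Fintype.mem_piFinset.1 hm b, fun b' h => ?_⟩
      obtain rfl := hf h
      rfl
  calc _ = ∑ l ∈ Fintype.piFinset T, (∏ a, q a (l a)) • x m := by
        rw [hT]
        refine Finset.sum_congr rfl fun l hl => ?_
        rw [← hT, Finset.mem_filter] at hl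
        simp only [hl.2]
    _ = (∏ a, ∑ j ∈ T a, q a j) • x m := by rw [Finset.prod_univ_sum, Finset.sum_smul]
    _ = (∏ b, q (f b) (m b)) • x m := by
        congr 1
        rw [← Finset.prod_subset (Finset.subset_univ (Finset.univ.image f)),
          Finset.prod_image hf.injOn]
        · refine Finset.prod_congr rfl fun b _ => ?_
          rw [hfb, Finset.sum_singleton]
        · intro a _ ha
          rw [← hq a, Finsupp.sum]
          refine Finset.sum_congr (Finset.filter_true_of_mem fun j _ b h => ?_) fun _ _ => rfl
          exact absurd (Finset.mem_image.2 ⟨b, Finset.mem_univ b, h⟩) ha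

end expect

/-! ### Faces of simplices -/

/-- The faces of the standard `n`-simplex. -/
abbrev SimplexFace (n : ℕ) : Type := Σ k : ℕ, Fin (k + 1) ↪o Fin (n + 1)

namespace SimplexFace

variable {m n : ℕ}

instance : Finite (SimplexFace n) := by
  have : ∀ k : Fin (n + 1), Finite (Fin (k.1 + 1) ↪o Fin (n + 1)) := fun k =>
    Finite.of_injective (fun φ => (φ : Fin (k.1 + 1) → Fin (n + 1))) DFunLike.coe_injective
  refine Finite.of_surjective (α := Σ k : Fin (n + 1), Fin (k.1 + 1) ↪o Fin (n + 1))
    (fun a => ⟨a.1.1, a.2⟩) fun ⟨k, φ⟩ => ?_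
  have hk : k + 1 ≤ n + 1 := by simpa using Fintype.card_le_of_injective φ φ.injective
  exact ⟨⟨⟨k, hk⟩, φ⟩, rfl⟩

noncomputable instance : Fintype (SimplexFace n) := Fintype.ofFinite _

/-- The face `f ∘ φ`. -/
def push (f : Fin (m + 1) ↪o Fin (n + 1)) (a : SimplexFace m) : SimplexFace n :=
  ⟨a.1, a.2.trans f⟩

theorem push_injective (f : Fin (m + 1) ↪o Fin (n + 1)) : Function.Injective (push f) := by
  rintro ⟨k, φ⟩ ⟨k', φ'⟩ h
  obtain rfl : k = k' := congrArg Sigma.fst h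
  have h2 : φ.trans f = φ'.trans f := eq_of_heq (Sigma.mk.inj h).2
  congr 1
  ext i : 1
  exact f.injective (DFunLike.congr_fun h2 i)

/-- A face that avoids the initial vertex, as a face of the opposite simplex. -/
def lower {k : ℕ} (φ : Fin (k + 1) ↪o Fin (n + 2)) (h : ∀ i, φ i ≠ 0) :
    Fin (k + 1) ↪o Fin (n + 1) :=
  OrderEmbedding.ofStrictMono (fun i => (φ i).pred (h i)) fun i j hij => by
    simpa using hij

theorem lower_trans_succAbove_zero {k : ℕ} (φ : Fin (k + 1) ↪o Fin (n + 1))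
    (h : ∀ i, φ.trans (Fin.succAboveOrderEmb 0) i ≠ 0) :
    lower (φ.trans (Fin.succAboveOrderEmb 0)) h = φ := by
  ext i : 1
  exact Fin.pred_succ (φ i) (h := Fin.succ_ne_zero _)

theorem lower_trans_succAbove_succ {k : ℕ} (φ : Fin (k + 1) ↪o Fin (n + 2)) (i : Fin (n + 2))
    (h : ∀ t, φ.trans (Fin.succAboveOrderEmb i.succ) t ≠ 0) (h' : ∀ t, φ t ≠ 0) :
    lower (φ.trans (Fin.succAboveOrderEmb i.succ)) h =
      (lower φ h').trans (Fin.succAboveOrderEmb i) := by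
  ext t : 1
  refine Fin.succ_injective _ ((Fin.succ_pred _ (h t)).trans ?_)
  change i.succ.succAbove (φ t) = (i.succAbove ((φ t).pred (h' t))).succ
  rw [← Fin.succ_succAbove_succ, Fin.succ_pred]

theorem lower_trans {k : ℕ} (φ : Fin (k + 1) ↪o Fin (n + 2)) (h : ∀ i, φ i ≠ 0) :
    (lower φ h).trans (Fin.succAboveOrderEmb 0) = φ := by
  ext i : 1
  exact Fin.succ_pred _ (h i)

theorem trans_succAbove_succ_ne_zero_iff {k : ℕ} (φ : Fin (k + 1) ↪o Fin (n + 2))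
    (i : Fin (n + 2)) (t : Fin (k + 1)) :
    φ.trans (Fin.succAboveOrderEmb i.succ) t ≠ 0 ↔ φ t ≠ 0 :=
  not_congr (Fin.succAbove_eq_zero_iff (Fin.succ_ne_zero i))

end SimplexFace

/-! ### Cochains without Real structure -/

namespace AbRealPresheaf

variable {X : RealSimplicialSpace.{u}} (F : AbRealPresheaf.{u, v} X) {C : RealCover X}

/-- The differential of a family of sections that need not be Real. -/
def dFamily (n : ℕ) (b : ∀ l : C.natural.J n, F.sec n (C.natural.U l)) (l : C.natural.J (n + 1)) :
    F.sec (n + 1) (C.natural.U l) :=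
  ∑ k : Fin (n + 2), (-1 : ℤ) ^ (k : ℕ) •
    F.pull (Fin.succAboveOrderEmb k).toOrderHom
      (C.natural.U (C.naturalPre.face (Fin.succAboveOrderEmb k) l)) (C.natural.U l)
      (C.naturalPre.map_mem (Fin.succAboveOrderEmb k) l)
      (b (C.naturalPre.face (Fin.succAboveOrderEmb k) l))

theorem natural_mem_iff_bar {n : ℕ} (l : C.natural.J n) (x : X.obj n) :
    x ∈ C.natural.U l ↔ X.rho n x ∈ C.natural.U (C.natural.bar l) := by
  rw [C.natural.mem_U_bar, X.rho_rho]

/-- The conjugate of a family of sections. -/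
def conjFamily (n : ℕ) (b : ∀ l : C.natural.J n, F.sec n (C.natural.U l)) (l : C.natural.J n) :
    F.sec n (C.natural.U l) :=
  F.sig n _ _ (natural_mem_iff_bar l) (b (C.natural.bar l))

theorem dFamily_conjFamily (n : ℕ) (b : ∀ l : C.natural.J n, F.sec n (C.natural.U l))
    (l : C.natural.J (n + 1)) :
    F.dFamily n (F.conjFamily n b) l = F.conjFamily (n + 1) (F.dFamily n b) l := by
  simp only [dFamily, conjFamily, map_sum, map_zsmul]
  refine Finset.sum_congr rfl fun k _ => ?_
  congr 1
  exact (F.sig_pull _ _ _ _ _ (natural_mem_iff_bar _) _ _ _ _).symm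

theorem conjFamily_of_mem_cochains {n : ℕ} (c : F.cochains C.natural n) (l : C.natural.J n) :
    F.conjFamily n c.1 l = c.1 l := by
  have h := c.2 l
  rw [conjFamily, h, F.sig_sig]

/-- A family plus its conjugate is Real. -/
theorem add_conjFamily_mem (n : ℕ) (b : ∀ l : C.natural.J n, F.sec n (C.natural.U l)) :
    b + F.conjFamily n b ∈ F.cochains C.natural n := by
  intro l
  have key : ∀ (l' : C.natural.J n) (e : l' = l)
      (h : ∀ x, x ∈ C.natural.U (C.natural.bar l) ↔ X.rho n x ∈ C.natural.U l'),
      F.sig n _ _ h (b l') = F.sig n _ _ (C.natural.mem_U_bar l) (b l) := by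
    rintro l' rfl h; rfl
  rw [Pi.add_apply, Pi.add_apply, map_add, add_comm]
  congr 1
  · exact key _ (C.natural.bar_bar l) _
  · rw [conjFamily, F.sig_sig]

/-- If twice the differential of some family is the Real cochain `c`, then `c` is a coboundary. -/
theorem mem_coboundaries_of_dFamily
    (hF : ∀ n (U : Opens (X.obj n)) (x y : F.sec n U), x + x = y + y → x = y) {n : ℕ}
    (c : F.cochains C.natural (n + 1)) (b : ∀ l : C.natural.J n, F.sec n (C.natural.U l))
    (h : ∀ l, F.dFamily n b l + F.dFamily n b l = c.1 l) :
    c ∈ F.coboundaries C.naturalPre (n + 1) := by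
  -- Conjugation commutes with the differential and fixes `c`, so the conjugate of `b` satisfies the
  -- same equation as `b`. The sum of both equations is twice the desired one, and `hF` cancels the
  -- factor.
  refine ⟨⟨_, F.add_conjFamily_mem n b⟩, Subtype.ext (funext fun l => ?_)⟩
  have h1 : F.dFamily n (b + F.conjFamily n b) l =
      F.dFamily n b l + F.dFamily n (F.conjFamily n b) l := by
    simp only [dFamily, Pi.add_apply, map_add, smul_add, Finset.sum_add_distrib]
  change F.dFamily n (b + F.conjFamily n b) l = c.1 l
  refine hF _ _ _ _ ?_
  have h2 : F.dFamily n (F.conjFamily n b) l + F.dFamily n (F.conjFamily n b) l = c.1 l := by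
    rw [dFamily_conjFamily, conjFamily, ← map_add, h]
    exact F.conjFamily_of_mem_cochains c l
  rw [h1, add_add_add_comm, h, h2]

/-- Čech cohomology vanishes when every cocycle for every cover is a coboundary. -/
theorem subsingleton_cechHR {n : ℕ}
    (h : ∀ (C : RealCover X) (c : F.cochains C.natural n), F.d C.naturalPre n c = 0 →
      c ∈ F.coboundaries C.naturalPre n) : Subsingleton (F.CechHR n) := by
  have h1 : ∀ C : RealCover X, Subsingleton (F.HR C n) := fun C =>
    QuotientAddGroup.subsingleton_iff.2 (eq_top_iff.2 fun c _ => h C c.1 c.2)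
  have h2 : Subsingleton (DirectSum (CechIndex X n) fun C => F.HR C.1 n) :=
    ⟨fun a b => DFinsupp.ext fun C => (h1 C.1).elim _ _⟩
  exact (QuotientAddGroup.mk'_surjective _).subsingleton

end AbRealPresheaf

namespace RealRep

open Filter Topology

variable {X : Type u'} {G : Type u} [TopologicalSpace X] [TopologicalSpace G]
  {𝓖 : RealGroupoid X G} {𝕂 : Type} [RCLike 𝕂] {bar : 𝕂 → 𝕂} {k : ℕ}
  (R : RealRep.{u, u', v} 𝓖 𝕂 bar k)

/-! ### Extension of sections by zero -/

variable {R} {n : ℕ}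

open Classical in
/-- The value at `φ` of a section over `U`, and zero if `φ` is not in `U`. -/
noncomputable def extend (U : Opens (𝓖.toTopGroupoid.Nerve n)) (c : R.sections n U)
    (φ : 𝓖.toTopGroupoid.Nerve n) {x : X} (h : φ.vert (Fin.last n) = x) : R.E x :=
  if hφ : φ ∈ U then h ▸ c.1 ⟨φ, hφ⟩ else 0

theorem extend_of_mem {U : Opens (𝓖.toTopGroupoid.Nerve n)} (c : R.sections n U)
    {φ : 𝓖.toTopGroupoid.Nerve n} (hφ : φ ∈ U) : R.extend U c φ rfl = c.1 ⟨φ, hφ⟩ :=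
  dif_pos hφ

theorem extend_congr {U : Opens (𝓖.toTopGroupoid.Nerve n)} (c : R.sections n U)
    {φ ψ : 𝓖.toTopGroupoid.Nerve n} (e : φ = ψ) {x : X} (h : φ.vert (Fin.last n) = x)
    (h' : ψ.vert (Fin.last n) = x) : R.extend U c φ h = R.extend U c ψ h' := by
  subst e; rfl

/-- Extension by zero is continuous only at points of `U`; elsewhere the vanishing of the weights
has to compensate. -/
theorem continuousAt_extend {U : Opens (𝓖.toTopGroupoid.Nerve n)} (c : R.sections n U)
    {φ : 𝓖.toTopGroupoid.Nerve n} (hφ : φ ∈ U) :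
    ContinuousAt (fun φ => (⟨φ.vert (Fin.last n), R.extend U c φ rfl⟩ : R.Tot)) φ := by
  rw [← (U.isOpen.isOpenEmbedding_subtypeVal).continuousAt_iff (x := ⟨φ, hφ⟩)]
  refine Continuous.continuousAt (Continuous.congr c.2 fun ψ => ?_)
  simp only [Function.comp_apply, extend_of_mem c ψ.2]
  rfl

theorem extend_pullSection {m : ℕ} (f : Fin (m + 1) →o Fin (n + 1))
    (V : Opens (𝓖.toTopGroupoid.Nerve m)) (U : Opens (𝓖.toTopGroupoid.Nerve n))
    (h : ∀ φ ∈ U, φ.map f ∈ V) (c : R.sections m V) {φ : 𝓖.toTopGroupoid.Nerve n} (hφ : φ ∈ U)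
    {x : X} (hx : φ.vert (Fin.last n) = x) :
    R.extend U (R.pullSection f V U h c) φ hx =
      R.act (φ.1 (Fin.last n) (f (Fin.last m))) (φ.s_eq _ _) ((φ.r_eq _ _).trans hx)
        (R.extend V c (φ.map f) rfl) := by
  subst hx
  exact (extend_of_mem _ hφ).trans (congrArg (R.act _ _ _) (extend_of_mem c (h φ hφ)).symm)

theorem extend_zero (U : Opens (𝓖.toTopGroupoid.Nerve n)) (φ : 𝓖.toTopGroupoid.Nerve n) {x : X}
    (h : φ.vert (Fin.last n) = x) : R.extend U 0 φ h = 0 := by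
  subst h
  by_cases hφ : φ ∈ U
  · exact extend_of_mem _ hφ
  · simp [extend, hφ]

theorem extend_sum {U : Opens (𝓖.toTopGroupoid.Nerve n)} {ι : Type*} (s : Finset ι)
    (c : ι → R.sections n U) {φ : 𝓖.toTopGroupoid.Nerve n} (a : ι → ℤ) {x : X}
    (h : φ.vert (Fin.last n) = x) :
    R.extend U (∑ i ∈ s, a i • c i) φ h = ∑ i ∈ s, a i • R.extend U (c i) φ h := by
  subst h
  by_cases hφ : φ ∈ U
  · simp only [extend_of_mem _ hφ]
    simp [Finset.sum_apply]
  · simp [extend, hφ]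

theorem sections_add_self_injective {U : Opens (𝓖.toTopGroupoid.Nerve n)} (c d : R.sections n U)
    (h : c + c = d + d) : c = d := by
  refine Subtype.ext (funext fun φ => ?_)
  have h1 : c.1 φ + c.1 φ = d.1 φ + d.1 φ := congrFun (congrArg Subtype.val h) φ
  rw [← two_smul 𝕂, ← two_smul 𝕂 (d.1 φ)] at h1
  exact smul_right_injective _ (two_ne_zero (α := 𝕂)) h1

/-! ### Integration of sections of a Real representation -/

variable (R)

/-- Fibre coordinates in a trivialization. -/
noncomputable def chart (j : R.ι) {x : X} (hx : x ∈ (R.triv j).baseSet) :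
    R.E x ≃ₗ[𝕂] (Fin k → 𝕂) :=
  have := R.triv_linear j
  (R.triv j).linearEquivAt 𝕂 x hx

theorem chart_apply (j : R.ι) {x : X} (hx : x ∈ (R.triv j).baseSet) (ξ : R.E x) :
    R.chart j hx ξ = (R.triv j ⟨x, ξ⟩).2 := rfl

/-- Some fibre coordinates. -/
noncomputable def coord (x : X) : R.E x ≃ₗ[𝕂] (Fin k → 𝕂) :=
  R.chart (R.triv_covers x).choose (R.triv_covers x).choose_spec

/-- Continuity and compact support for functions from a fibre of the range map to a fibre of the
bundle. -/
def FiberCc {x y : X} (f : 𝓖.toTopGroupoid.Fiber x → R.E y) : Prop :=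
  (Continuous fun γ => R.coord y (f γ)) ∧ HasCompactSupport fun γ => R.coord y (f γ)

variable {R}

/-- Linear maps between finite dimensional spaces are continuous, so the arbitrary choice in `coord`
does not matter. -/
theorem FiberCc.map {x y : X} {f : 𝓖.toTopGroupoid.Fiber x → R.E y} (hf : R.FiberCc f)
    {W : Type*} [NormedAddCommGroup W] [NormedSpace 𝕂 W] (L : R.E y →ₗ[𝕂] W) :
    (Continuous fun γ => L (f γ)) ∧ HasCompactSupport fun γ => L (f γ) := by
  have h : (fun γ => L (f γ)) =
      fun γ => (L.comp (R.coord y).symm.toLinearMap).toContinuousLinearMap (R.coord y (f γ)) := by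
    ext γ; simp
  rw [h]
  exact ⟨(ContinuousLinearMap.continuous _).comp hf.1, hf.2.comp_left (map_zero _)⟩

theorem FiberCc.of_chart {x y : X} {f : 𝓖.toTopGroupoid.Fiber x → R.E y} (j : R.ι)
    (hy : y ∈ (R.triv j).baseSet) (hc : Continuous fun γ => R.chart j hy (f γ))
    (hs : HasCompactSupport fun γ => R.chart j hy (f γ)) : R.FiberCc f := by
  have h : (fun γ => R.coord y (f γ)) =
      fun γ => ((R.coord y).toLinearMap.comp (R.chart j hy).symm.toLinearMap).toContinuousLinearMap
        (R.chart j hy (f γ)) := by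
    ext γ; simp
  unfold FiberCc
  rw [h]
  exact ⟨(ContinuousLinearMap.continuous _).comp hc, hs.comp_left (map_zero _)⟩

theorem FiberCc.linearMap {x y z : X} {f : 𝓖.toTopGroupoid.Fiber x → R.E y}
    (hf : R.FiberCc f) (L : R.E y →ₗ[𝕂] R.E z) : R.FiberCc fun γ => L (f γ) :=
  hf.map ((R.coord z).toLinearMap.comp L)

theorem FiberCc.translate {g : G} {x y z : X} (hx : 𝓖.s g = x) (hy : 𝓖.r g = y)
    {f : 𝓖.toTopGroupoid.Fiber y → R.E z} (hf : R.FiberCc f) :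
    R.FiberCc fun γ => f (𝓖.translate g hx hy γ) :=
  ⟨hf.1.comp (𝓖.translate g hx hy).continuous, hf.2.comp_homeomorph (𝓖.translate g hx hy)⟩

variable [MeasurableSpace G] (haar : 𝓖.toTopGroupoid.HaarSystem)

/-- The integral of a function from a fibre of the range map to a fibre of the bundle. -/
noncomputable def fiberIntegral {x y : X} (f : 𝓖.toTopGroupoid.Fiber x → R.E y) : R.E y :=
  (R.coord y).symm (∫ γ, R.coord y (f γ) ∂(haar.fiberMeasure x))

theorem fiberIntegral_smul_const {x y : X} (w : 𝓖.toTopGroupoid.Fiber x → ℝ) (ξ : R.E y) :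
    (fiberIntegral haar fun γ => ((w γ : ℝ) : 𝕂) • ξ) =
      ((∫ γ, w γ ∂(haar.fiberMeasure x) : ℝ) : 𝕂) • ξ := by
  simp only [fiberIntegral, map_smul]
  rw [LinearEquiv.symm_apply_eq, map_smul]
  have h : ∀ (t : ℝ) (a : Fin k → 𝕂), (t : 𝕂) • a = t • a := fun t a =>
    funext fun i => (RCLike.real_smul_eq_coe_mul t (a i)).symm
  simp only [h]
  exact integral_smul_const _ _

variable [T2Space X] [BorelSpace G]

/-- The integral may be computed in any linear coordinates. This permits a single chart over a
neighbourhood, although `coord` is chosen pointwise without any continuity. -/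
theorem map_fiberIntegral {x y : X} {f : 𝓖.toTopGroupoid.Fiber x → R.E y} (hf : R.FiberCc f)
    {W : Type*} [NormedAddCommGroup W] [NormedSpace 𝕂 W] [NormedSpace ℝ W] [CompleteSpace W]
    (L : R.E y →ₗ[𝕂] W) :
    L (fiberIntegral haar f) = ∫ γ, L (f γ) ∂(haar.fiberMeasure x) := by
  have h := (L.comp (R.coord y).symm.toLinearMap).toContinuousLinearMap.integral_comp_comm
    (haar.integrable_fiber hf.1 hf.2)
  simpa [fiberIntegral] using h.symm

theorem linearMap_fiberIntegral {x y z : X} {f : 𝓖.toTopGroupoid.Fiber x → R.E y}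
    (hf : R.FiberCc f) (L : R.E y →ₗ[𝕂] R.E z) :
    L (fiberIntegral haar f) = fiberIntegral haar fun γ => L (f γ) := by
  rw [fiberIntegral.eq_1 haar (fun γ => L (f γ)), LinearEquiv.eq_symm_apply]
  exact map_fiberIntegral haar hf ((R.coord z).toLinearMap.comp L)

theorem fiberIntegral_sum {ι : Type*} (s : Finset ι) {x y : X}
    {f : ι → 𝓖.toTopGroupoid.Fiber x → R.E y} (hf : ∀ i ∈ s, R.FiberCc (f i)) :
    (fiberIntegral haar fun γ => ∑ i ∈ s, f i γ) = ∑ i ∈ s, fiberIntegral haar (f i) := by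
  simp only [fiberIntegral, map_sum]
  rw [integral_finsetSum _ fun i hi => haar.integrable_fiber (hf i hi).1 (hf i hi).2, map_sum]

theorem fiberIntegral_translate [T2Space G] [LocallyCompactSpace G] [NormalSpace G] (g : G)
    {x y z : X} (hx : 𝓖.s g = x) (hy : 𝓖.r g = y) {f : 𝓖.toTopGroupoid.Fiber y → R.E z}
    (hf : R.FiberCc f) :
    (fiberIntegral haar fun γ => f (𝓖.translate g hx hy γ)) = fiberIntegral haar f :=
  congrArg _ (haar.integral_translate g hx hy hf.1 hf.2)

end RealRep

/-! ### The contraction of the cochain complex -/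

namespace RealRep

open Filter Topology TopGroupoid

variable {X : Type u'} {G : Type u} [TopologicalSpace X] [TopologicalSpace G]
  {𝓖 : RealGroupoid X G} {𝕂 : Type} [RCLike 𝕂] {bar : 𝕂 → 𝕂} {k : ℕ}
  {R : RealRep.{u, u', v} 𝓖 𝕂 bar k} {C : RealCover 𝓖.nerve}

/-- The values at a point of a partition of unity, as weights. -/
noncomputable def pouWeight (𝕂 : Type) [RCLike 𝕂] {ι Y : Type*} [TopologicalSpace Y]
    (ρ : PartitionOfUnity ι Y) (y : Y) : ι →₀ 𝕂 :=
  Finsupp.onFinset (ρ.finsupport y) (fun i => ((ρ i y : ℝ) : 𝕂)) fun i h =>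
    (ρ.mem_finsupport y).2 fun h0 => h (by simp [h0])

theorem sum_pouWeight {ι Y : Type*} [TopologicalSpace Y] (ρ : PartitionOfUnity ι Y) (y : Y) :
    ((pouWeight 𝕂 ρ y).sum fun _ t => t) = 1 := by
  rw [pouWeight, Finsupp.sum_of_support_subset _ Finsupp.support_onFinset_subset _ fun _ _ => rfl]
  change ∑ i ∈ ρ.finsupport y, ((ρ i y : ℝ) : 𝕂) = 1
  exact_mod_cast congrArg (RCLike.ofReal (K := 𝕂)) (ρ.sum_finsupport (Set.mem_univ y))

/-- An index for the simplices in degree `n` of the generated cover. -/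
abbrev faceIndex {n : ℕ} (l : ∀ a : SimplexFace n, C.J a.1) : C.natural.J n := fun j φ => l ⟨j, φ⟩

variable (ρ : ∀ n, PartitionOfUnity (C.J n) (𝓖.toTopGroupoid.Nerve n))

/-- The weights on extensions of `m` to an index one degree higher: those on faces through the
initial vertex are given by the partitions of unity, and on the other faces the extension is
prescribed. -/
noncomputable def coneWeights (𝕂 : Type) [RCLike 𝕂] {n : ℕ} (m : C.natural.J n)
    (φ : 𝓖.toTopGroupoid.Nerve (n + 1)) (a : SimplexFace (n + 1)) : C.J a.1 →₀ 𝕂 :=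
  open Classical in
  if h : ∀ i, a.2 i ≠ 0 then Finsupp.single (m a.1 (SimplexFace.lower a.2 h)) 1
  else pouWeight 𝕂 (ρ a.1) (φ.map a.2.toOrderHom)

variable {n : ℕ}

theorem sum_coneWeights (m : C.natural.J n) (φ : 𝓖.toTopGroupoid.Nerve (n + 1))
    (a : SimplexFace (n + 1)) : ((coneWeights ρ 𝕂 m φ a).sum fun _ t => t) = 1 := by
  unfold coneWeights
  split_ifs with h
  · exact Finsupp.sum_single_index rfl
  · exact sum_pouWeight _ _

/-- The face opposite the new vertex has all its indices prescribed by `m`, so averaging over it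
returns the value of `c m` itself. -/
theorem coneWeights_push_zero (m : C.natural.J n) (φ : 𝓖.toTopGroupoid.Nerve (n + 1))
    (a : SimplexFace n) :
    coneWeights ρ 𝕂 m φ (a.push (Fin.succAboveOrderEmb 0)) = Finsupp.single (m a.1 a.2) 1 := by
  have h : ∀ i, a.2.trans (Fin.succAboveOrderEmb 0) i ≠ 0 := fun i => Fin.succ_ne_zero (a.2 i)
  refine (dif_pos h).trans ?_
  exact congrArg (fun φ => Finsupp.single (m a.1 φ) (1 : 𝕂))
    (SimplexFace.lower_trans_succAbove_zero a.2 h)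

/-- The map that avoids `i + 1` fixes the initial vertex and so respects the distinction between
faces through it and faces avoiding it. The weights restrict to those of the cone over the `i`-th
face. -/
theorem coneWeights_push_succ (m : C.natural.J (n + 1)) (φ : 𝓖.toTopGroupoid.Nerve (n + 2))
    (i : Fin (n + 2)) (a : SimplexFace (n + 1)) :
    coneWeights ρ 𝕂 m φ (a.push (Fin.succAboveOrderEmb i.succ)) =
      coneWeights ρ 𝕂 (C.naturalPre.face (Fin.succAboveOrderEmb i) m)
        (φ.map (Fin.succAboveOrderEmb i.succ).toOrderHom) a := by
  by_cases h : ∀ t, a.2 t ≠ 0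
  · have h' : ∀ t, a.2.trans (Fin.succAboveOrderEmb i.succ) t ≠ 0 := fun t =>
      (SimplexFace.trans_succAbove_succ_ne_zero_iff a.2 i t).2 (h t)
    refine (dif_pos h').trans (Eq.trans ?_ (dif_pos h).symm)
    exact congrArg (fun φ => Finsupp.single (m a.1 φ) (1 : 𝕂))
      (SimplexFace.lower_trans_succAbove_succ a.2 i h' h)
  · have h' : ¬ ∀ t, a.2.trans (Fin.succAboveOrderEmb i.succ) t ≠ 0 := fun h' => h fun t =>
      (SimplexFace.trans_succAbove_succ_ne_zero_iff a.2 i t).1 (h' t)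
    unfold coneWeights
    rw [dif_neg h]
    exact dif_neg h'

variable {ρ} in
-- Prescribed faces lie in their open sets because the base of the cone lies in that of `m`; for the
-- others, a nonzero weight puts the face in the support of the partition function.
theorem mem_of_coneWeights_ne_zero
    (hρ : ∀ n (j : C.J n) (φ : 𝓖.toTopGroupoid.Nerve n), φ ∈ tsupport (ρ n j) → φ ∈ C.U j)
    {m : C.natural.J n} {φ : 𝓖.toTopGroupoid.Nerve (n + 1)}
    (hφ : φ.map (Fin.succAboveOrderEmb 0).toOrderHom ∈ C.natural.U m)
    {l : ∀ a : SimplexFace (n + 1), C.J a.1} (hl : ∀ a, coneWeights ρ 𝕂 m φ a (l a) ≠ 0) :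
    φ ∈ C.natural.U (faceIndex l) := by
  intro j ψ
  have h := hl ⟨j, ψ⟩
  unfold coneWeights at h
  split_ifs at h with hψ
  · have h1 : l ⟨j, ψ⟩ = m j (SimplexFace.lower ψ hψ) := by
      by_contra hn
      exact h (Finsupp.single_eq_of_ne hn)
    change _ ∈ C.U (l ⟨j, ψ⟩)
    rw [h1]
    have h2 := hφ j (SimplexFace.lower ψ hψ)
    have h3 : φ.map ψ.toOrderHom = (φ.map (Fin.succAboveOrderEmb 0).toOrderHom).map
        (SimplexFace.lower ψ hψ).toOrderHom := by
      conv_lhs => rw [← SimplexFace.lower_trans ψ hψ]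
      rfl
    exact Set.mem_of_eq_of_mem h3 h2
  · refine hρ j (l ⟨j, ψ⟩) _ (subset_tsupport _ fun h0 => h ?_)
    exact (congrArg (RCLike.ofReal (K := 𝕂)) h0).trans RCLike.ofReal_zero

variable (c : ∀ l : C.natural.J (n + 1), R.sections (n + 1) (C.natural.U l))

/-- The mean value of a family of sections over all extensions of the index `m`. -/
noncomputable def coneSum (m : C.natural.J n) (φ : 𝓖.toTopGroupoid.Nerve (n + 1)) {x : X}
    (h : φ.vert (Fin.last (n + 1)) = x) : R.E x :=
  weightedSum (coneWeights ρ 𝕂 m φ) fun l =>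
    R.extend (C.natural.U (faceIndex l)) (c (faceIndex l)) φ h

theorem tot_coneSum (m : C.natural.J n) (φ : 𝓖.toTopGroupoid.Nerve (n + 1)) {x : X}
    (h : φ.vert (Fin.last (n + 1)) = x) :
    (⟨x, coneSum ρ c m φ h⟩ : R.Tot) = ⟨φ.vert (Fin.last (n + 1)), coneSum ρ c m φ rfl⟩ := by
  subst h; rfl

theorem continuous_map_nerve {m n : ℕ} (f : Fin (m + 1) →o Fin (n + 1)) :
    Continuous fun φ : 𝓖.toTopGroupoid.Nerve n => φ.map f :=
  𝓖.nerve.continuous_map f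

theorem continuous_coneWeights (m : C.natural.J n) (a : SimplexFace (n + 1)) (j : C.J a.1) :
    Continuous fun φ => coneWeights ρ 𝕂 m φ a j := by
  unfold coneWeights
  split_ifs with h
  · exact continuous_const
  · exact RCLike.continuous_ofReal.comp ((ρ a.1 j).continuous.comp (continuous_map_nerve _))

/-- Locally, finitely many extensions carry all the weights. -/
theorem exists_finset_coneWeights (m : C.natural.J n) (φ₀ : 𝓖.toTopGroupoid.Nerve (n + 1)) :
    ∃ T : ∀ a : SimplexFace (n + 1), Finset (C.J a.1),
      ∀ᶠ φ in 𝓝 φ₀, ∀ a, (coneWeights ρ 𝕂 m φ a).support ⊆ T a := by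
  have h : ∀ a : SimplexFace (n + 1), ∃ T : Finset (C.J a.1),
      ∀ᶠ φ in 𝓝 φ₀, (coneWeights ρ 𝕂 m φ a).support ⊆ T := by
    intro a
    unfold coneWeights
    split_ifs with h
    · exact ⟨_, Eventually.of_forall fun _ => Finsupp.support_single_subset⟩
    · refine ⟨(ρ a.1).fintsupport (φ₀.map a.2.toOrderHom), ?_⟩
      filter_upwards [(continuous_map_nerve a.2.toOrderHom).continuousAt.eventually
        ((ρ a.1).eventually_finsupport_subset _)] with φ hφ
      exact Finsupp.support_onFinset_subset.trans hφ
  choose T hT using h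
  exact ⟨T, eventually_all.2 hT⟩

variable {ρ}

theorem eventually_coneWeights_eq_zero
    (hρ : ∀ n (j : C.J n) (φ : 𝓖.toTopGroupoid.Nerve n), φ ∈ tsupport (ρ n j) → φ ∈ C.U j)
    {m : C.natural.J n} {φ₀ : 𝓖.toTopGroupoid.Nerve (n + 1)}
    (hφ : φ₀.map (Fin.succAboveOrderEmb 0).toOrderHom ∈ C.natural.U m)
    {l : ∀ a : SimplexFace (n + 1), C.J a.1} (hl : φ₀ ∉ C.natural.U (faceIndex l)) :
    ∀ᶠ φ in 𝓝 φ₀, ∏ a, coneWeights ρ 𝕂 m φ a (l a) = 0 := by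
  obtain ⟨j, hj⟩ := not_forall.1 hl
  obtain ⟨ψ, hψ⟩ := not_forall.1 hj
  suffices h : ∀ᶠ φ in 𝓝 φ₀, coneWeights ρ 𝕂 m φ ⟨j, ψ⟩ (l ⟨j, ψ⟩) = 0 by
    filter_upwards [h] with φ h
    exact Finset.prod_eq_zero (Finset.mem_univ _) h
  unfold coneWeights
  split_ifs with hψ0
  · refine Eventually.of_forall fun φ => Finsupp.single_eq_of_ne fun h1 => hψ ?_
    have h2 := hφ j (SimplexFace.lower ψ hψ0)
    have h3 : φ₀.map ψ.toOrderHom = (φ₀.map (Fin.succAboveOrderEmb 0).toOrderHom).map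
        (SimplexFace.lower ψ hψ0).toOrderHom := by
      conv_lhs => rw [← SimplexFace.lower_trans ψ hψ0]
      rfl
    change _ ∈ C.U (l ⟨j, ψ⟩)
    rw [h1]
    exact Set.mem_of_eq_of_mem h3 h2
  · have h1 : φ₀.map ψ.toOrderHom ∈ (tsupport (ρ j (l ⟨j, ψ⟩)))ᶜ := fun h => hψ (hρ _ _ _ h)
    filter_upwards [(continuous_map_nerve ψ.toOrderHom).continuousAt.preimage_mem_nhds
      ((isClosed_tsupport _).isOpen_compl.mem_nhds h1)] with φ hφ'
    change ((ρ j (l ⟨j, ψ⟩) (φ.map ψ.toOrderHom) : ℝ) : 𝕂) = 0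
    rw [image_eq_zero_of_notMem_tsupport hφ', RCLike.ofReal_zero]

/-- Near `φ₀` the sum runs over a fixed finite set of indices. If `φ₀` lies in the open set of an
index, its term is continuous at `φ₀`. If not, its weight vanishes on a whole neighbourhood, since
the closed supports of the partition are subordinate to the cover. -/
theorem continuousAt_coneSum
    (hρ : ∀ n (j : C.J n) (φ : 𝓖.toTopGroupoid.Nerve n), φ ∈ tsupport (ρ n j) → φ ∈ C.U j)
    (m : C.natural.J n) (j : R.ι) {φ₀ : 𝓖.toTopGroupoid.Nerve (n + 1)}
    (hφ : φ₀.map (Fin.succAboveOrderEmb 0).toOrderHom ∈ C.natural.U m)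
    (hj : φ₀.vert (Fin.last (n + 1)) ∈ (R.triv j).baseSet) :
    ContinuousAt (fun φ => (R.triv j ⟨φ.vert (Fin.last (n + 1)), coneSum ρ c m φ rfl⟩).2) φ₀ := by
  classical
  obtain ⟨T, hT⟩ := exists_finset_coneWeights (𝕂 := 𝕂) ρ m φ₀
  have hbase : ∀ᶠ φ in 𝓝 φ₀, φ.vert (Fin.last (n + 1)) ∈ (R.triv j).baseSet :=
    (Nerve.continuous_vertex _).continuousAt.eventually ((R.triv j).open_baseSet.mem_nhds hj)
  have heq : (fun φ => ∑ l ∈ Fintype.piFinset T, (∏ a, coneWeights ρ 𝕂 m φ a (l a)) •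
      (R.triv j ⟨φ.vert (Fin.last (n + 1)),
        R.extend (C.natural.U (faceIndex l)) (c (faceIndex l)) φ rfl⟩).2) =ᶠ[𝓝 φ₀]
      fun φ => (R.triv j ⟨φ.vert (Fin.last (n + 1)), coneSum ρ c m φ rfl⟩).2 := by
    filter_upwards [hT, hbase] with φ h1 h2
    rw [← chart_apply R j h2, coneSum, weightedSum_eq_sum _ _ _ h1]
    simp only [map_sum, map_smul, chart_apply]
    congr!
  refine ContinuousAt.congr (tendsto_finsetSum _ fun l _ => ?_) heq
  by_cases hl : φ₀ ∈ C.natural.U (faceIndex l)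
  · have h0 : Continuous fun φ => ∏ a, coneWeights ρ 𝕂 m φ a (l a) :=
      continuous_finsetProd _ fun a _ => continuous_coneWeights ρ m a (l a)
    refine Tendsto.smul (h0.tendsto φ₀) ?_
    have h1 := continuousAt_extend (c (faceIndex l)) hl
    have h2 : (⟨φ₀.vert (Fin.last (n + 1)),
        R.extend (C.natural.U (faceIndex l)) (c (faceIndex l)) φ₀ rfl⟩ : R.Tot) ∈ (R.triv j).source :=
      (R.triv j).mem_source.2 hj
    exact (((R.triv j).tendsto_nhds_iff h2).1 h1).2
  · have h0 := eventually_coneWeights_eq_zero (𝕂 := 𝕂) hρ hφ hl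
    rw [h0.self_of_nhds, zero_smul]
    refine tendsto_const_nhds.congr' ?_
    filter_upwards [h0] with φ h
    rw [h, zero_smul]

end RealRep

/-! ### Vanishing of the cohomology -/

namespace RealRep

open Filter Topology TopGroupoid

variable {X : Type u'} {G : Type u} [TopologicalSpace X] [TopologicalSpace G]
  {𝓖 : RealGroupoid X G} {𝕂 : Type} [RCLike 𝕂] {bar : 𝕂 → 𝕂} {k : ℕ}
  {R : RealRep.{u, u', v} 𝓖 𝕂 bar k} {C : RealCover 𝓖.nerve}
  {ρ : ∀ n, PartitionOfUnity (C.J n) (𝓖.toTopGroupoid.Nerve n)} {n : ℕ}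

theorem act_extend_of_eq_unit {U : Opens (𝓖.toTopGroupoid.Nerve n)} (c : R.sections n U)
    {ψ : 𝓖.toTopGroupoid.Nerve n} {x : X} (h : ψ.vert (Fin.last n) = x) {g : G}
    (e : g = 𝓖.unit (ψ.vert (Fin.last n))) (hx : 𝓖.s g = ψ.vert (Fin.last n)) (hy : 𝓖.r g = x) :
    R.act g hx hy (R.extend U c ψ rfl) = R.extend U c ψ h := by
  subst h e; exact R.act_unit _

theorem act_coneSum_congr (c : ∀ l : C.natural.J (n + 1), R.sections (n + 1) (C.natural.U l))
    (m : C.natural.J n) {g g' : G} (eg : g = g') {ψ ψ' : 𝓖.toTopGroupoid.Nerve (n + 1)}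
    (eψ : ψ = ψ') {x y : X} (h : ψ'.vert (Fin.last (n + 1)) = x)
    (hx : 𝓖.s g = ψ.vert (Fin.last (n + 1))) (hx' : 𝓖.s g' = x) (hy : 𝓖.r g = y)
    (hy' : 𝓖.r g' = y) :
    R.act g hx hy (coneSum ρ c m ψ rfl) = R.act g' hx' hy' (coneSum ρ c m ψ' h) := by
  subst eg eψ h; rfl

theorem extend_dFamily (c : ∀ l : C.natural.J n, R.sections n (C.natural.U l))
    (l : C.natural.J (n + 1)) {φ : 𝓖.toTopGroupoid.Nerve (n + 1)} (hφ : φ ∈ C.natural.U l) {x : X}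
    (h : φ.vert (Fin.last (n + 1)) = x) :
    R.extend (C.natural.U l) (R.sheaf.dFamily n c l) φ h = ∑ t : Fin (n + 2), (-1 : ℤ) ^ (t : ℕ) •
      R.act (φ.1 (Fin.last (n + 1)) (t.succAbove (Fin.last n))) (φ.s_eq _ _) ((φ.r_eq _ _).trans h)
        (R.extend (C.natural.U (C.naturalPre.face (Fin.succAboveOrderEmb t) l))
          (c (C.naturalPre.face (Fin.succAboveOrderEmb t) l))
          (φ.map (Fin.succAboveOrderEmb t).toOrderHom) rfl) := by
  refine (extend_sum _ _ _ h).trans (Finset.sum_congr rfl fun t _ => ?_)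
  congr 1
  exact extend_pullSection (Fin.succAboveOrderEmb t).toOrderHom _ _
    (C.naturalPre.map_mem (Fin.succAboveOrderEmb t) l) _ hφ h

/-- The value of a cocycle in terms of its means over the cones with a given vertex. -/
theorem cocycle_eq_sum
    (hρ : ∀ n (j : C.J n) (φ : 𝓖.toTopGroupoid.Nerve n), φ ∈ tsupport (ρ n j) → φ ∈ C.U j)
    (c : ∀ l : C.natural.J (n + 1), R.sections (n + 1) (C.natural.U l))
    (hc : ∀ l, R.sheaf.dFamily (n + 1) c l = 0) (m : C.natural.J (n + 1))
    {φ : 𝓖.toTopGroupoid.Nerve (n + 1)} (hφ : φ ∈ C.natural.U m)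
    (γ : 𝓖.toTopGroupoid.Fiber (φ.vert (Fin.last (n + 1)))) :
    R.extend (C.natural.U m) (c m) φ rfl =
      ∑ i : Fin (n + 2), (-1 : ℤ) ^ (i : ℕ) •
        R.act (φ.1 (Fin.last (n + 1)) (i.succAbove (Fin.last n))) (φ.s_eq _ _) (φ.r_eq _ _)
          (coneSum ρ c (C.naturalPre.face (Fin.succAboveOrderEmb i) m)
            ((φ.map (Fin.succAboveOrderEmb i).toOrderHom).cone
              (𝓖.translate (φ.1 (i.succAbove (Fin.last n)) (Fin.last (n + 1))) (φ.s_eq _ _)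
                (φ.r_eq _ _) γ)) (Nerve.vert_cone_last _ _)) := by
  have hv := φ.vert_cone_last γ
  have h0 : (φ.cone γ).map (Fin.succAboveOrderEmb 0).toOrderHom ∈ C.natural.U m :=
    Set.mem_of_eq_of_mem (φ.map_zero_cone γ) hφ
  -- The cocycle identity on the cone, averaged over all extensions of the index `m`.
  have hzero : (weightedSum (coneWeights ρ 𝕂 m (φ.cone γ)) fun l =>
      R.extend (C.natural.U (faceIndex l)) (R.sheaf.dFamily (n + 1) c (faceIndex l))
        (φ.cone γ) hv) = 0 := by
    rw [← weightedSum_zero (V := R.E (φ.vert (Fin.last (n + 1)))) (coneWeights ρ 𝕂 m (φ.cone γ))]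
    refine weightedSum_congr fun l _ => ?_
    rw [hc]
    exact extend_zero _ _ hv
  -- The differential can be expanded because indices of nonzero weight contain the cone in their
  -- open set. The term of the `t`-th face sees only the indices of that face, and the remaining
  -- coordinates are dropped by `weightedSum_comp`.
  have hterm : (weightedSum (coneWeights ρ 𝕂 m (φ.cone γ)) fun l =>
      R.extend (C.natural.U (faceIndex l)) (R.sheaf.dFamily (n + 1) c (faceIndex l))
        (φ.cone γ) hv) = ∑ t : Fin (n + 3), (-1 : ℤ) ^ (t : ℕ) •
      R.act ((φ.cone γ).1 (Fin.last (n + 2)) (t.succAbove (Fin.last (n + 1))))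
        ((φ.cone γ).s_eq _ _) (((φ.cone γ).r_eq _ _).trans hv)
        (weightedSum (fun a => coneWeights ρ 𝕂 m (φ.cone γ)
            (SimplexFace.push (Fin.succAboveOrderEmb t) a)) fun l =>
          R.extend (C.natural.U (faceIndex l)) (c (faceIndex l))
            ((φ.cone γ).map (Fin.succAboveOrderEmb t).toOrderHom) rfl) := by
    calc _ = weightedSum (coneWeights ρ 𝕂 m (φ.cone γ)) fun l => ∑ t : Fin (n + 3),
          (-1 : ℤ) ^ (t : ℕ) • R.act ((φ.cone γ).1 (Fin.last (n + 2)) (t.succAbove (Fin.last (n + 1))))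
            ((φ.cone γ).s_eq _ _) (((φ.cone γ).r_eq _ _).trans hv)
            (R.extend
              (C.natural.U (faceIndex fun a => l (SimplexFace.push (Fin.succAboveOrderEmb t) a)))
              (c (faceIndex fun a => l (SimplexFace.push (Fin.succAboveOrderEmb t) a)))
              ((φ.cone γ).map (Fin.succAboveOrderEmb t).toOrderHom) rfl) :=
          weightedSum_congr fun l hl => extend_dFamily c _ (mem_of_coneWeights_ne_zero hρ h0 hl) hv
      _ = _ := by
          rw [weightedSum_sum]
          refine Finset.sum_congr rfl fun t _ => ?_
          rw [weightedSum_zsmul, ← map_weightedSum]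
          congr 2
          exact weightedSum_comp (SimplexFace.push (Fin.succAboveOrderEmb t))
            (SimplexFace.push_injective _) _ (sum_coneWeights ρ m _) fun l =>
              R.extend (C.natural.U (faceIndex l)) (c (faceIndex l))
                ((φ.cone γ).map (Fin.succAboveOrderEmb t).toOrderHom) rfl
  rw [hterm, Fin.sum_univ_succ] at hzero
  have hfirst : R.act ((φ.cone γ).1 (Fin.last (n + 2)) ((0 : Fin (n + 3)).succAbove (Fin.last (n + 1))))
        ((φ.cone γ).s_eq _ _) (((φ.cone γ).r_eq _ _).trans hv)
        (weightedSum (fun a => coneWeights ρ 𝕂 m (φ.cone γ)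
            (SimplexFace.push (Fin.succAboveOrderEmb 0) a)) fun l =>
          R.extend (C.natural.U (faceIndex l)) (c (faceIndex l))
            ((φ.cone γ).map (Fin.succAboveOrderEmb 0).toOrderHom) rfl) =
      R.extend (C.natural.U m) (c m) φ rfl := by
    simp only [coneWeights_push_zero]
    refine (congrArg (R.act _ _ _) (weightedSum_single
      (J := fun a : SimplexFace (n + 1) => C.J a.1) (fun a => m a.1 a.2) _)).trans ?_
    refine (act_extend_of_eq_unit (c m) hv ?_ _ _).trans (extend_congr _ (φ.map_zero_cone γ) _ _)
    exact (φ.cone γ).diag_eq _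
  have hrest : ∀ i : Fin (n + 2),
      R.act ((φ.cone γ).1 (Fin.last (n + 2)) (i.succ.succAbove (Fin.last (n + 1))))
        ((φ.cone γ).s_eq _ _) (((φ.cone γ).r_eq _ _).trans hv)
        (weightedSum (fun a => coneWeights ρ 𝕂 m (φ.cone γ)
            (SimplexFace.push (Fin.succAboveOrderEmb i.succ) a)) fun l =>
          R.extend (C.natural.U (faceIndex l)) (c (faceIndex l))
            ((φ.cone γ).map (Fin.succAboveOrderEmb i.succ).toOrderHom) rfl) =
      R.act (φ.1 (Fin.last (n + 1)) (i.succAbove (Fin.last n))) (φ.s_eq _ _) (φ.r_eq _ _)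
          (coneSum ρ c (C.naturalPre.face (Fin.succAboveOrderEmb i) m)
            ((φ.map (Fin.succAboveOrderEmb i).toOrderHom).cone
              (𝓖.translate (φ.1 (i.succAbove (Fin.last n)) (Fin.last (n + 1))) (φ.s_eq _ _)
                (φ.r_eq _ _) γ)) (Nerve.vert_cone_last _ _)) := by
    intro i
    simp only [coneWeights_push_succ]
    refine act_coneSum_congr c _ ?_ (φ.map_succ_cone γ i) _ _ _ _ _
    rw [← Fin.succ_last, ← Fin.succ_last, Fin.succ_succAbove_succ]
    exact φ.cone_succ_succ γ _ _
  rw [hfirst] at hzero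
  simp only [hrest] at hzero
  rw [Fin.val_zero, pow_zero, one_smul, ← eq_neg_iff_add_eq_zero] at hzero
  rw [hzero, ← Finset.sum_neg_distrib]
  -- The face `i + 1` of the cone corresponds to the face `i` of `φ`; the sign change from this
  -- shift cancels the one from moving the sum across the equation.
  refine Finset.sum_congr rfl fun i _ => ?_
  rw [Fin.val_succ, pow_succ, mul_neg_one, neg_smul, neg_neg]

end RealRep

/-! ### Integration over cones -/

namespace RealRep

open Filter Topology TopGroupoid

variable {X : Type u'} {G : Type u} [TopologicalSpace X] [TopologicalSpace G]
  {𝓖 : RealGroupoid X G} {𝕂 : Type} [RCLike 𝕂] {bar : 𝕂 → 𝕂} {k : ℕ}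
  {R : RealRep.{u, u', v} 𝓖 𝕂 bar k} {C : RealCover 𝓖.nerve}
  (ρ : ∀ n, PartitionOfUnity (C.J n) (𝓖.toTopGroupoid.Nerve n)) {n : ℕ} (w : X → ℝ)
  (c : ∀ l : C.natural.J (n + 1), R.sections (n + 1) (C.natural.U l))

/-- The integrand of the contraction. -/
noncomputable def coneIntegrand (m : C.natural.J n) (φ : 𝓖.toTopGroupoid.Nerve n)
    (γ : 𝓖.toTopGroupoid.Fiber (φ.vert (Fin.last n))) : R.E (φ.vert (Fin.last n)) :=
  ((w (𝓖.s γ.1) : ℝ) : 𝕂) • coneSum ρ c m (φ.cone γ) (φ.vert_cone_last γ)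

variable {ρ} {w}

theorem continuous_coneIntegrand
    (hρ : ∀ n (j : C.J n) (φ : 𝓖.toTopGroupoid.Nerve n), φ ∈ tsupport (ρ n j) → φ ∈ C.U j)
    (hw : Continuous w) (m : C.natural.J n) (j : R.ι) {Y : Type*} [TopologicalSpace Y]
    {f : Y → 𝓖.toTopGroupoid.Nerve n} (hf : Continuous f) (hU : ∀ y, f y ∈ C.natural.U m)
    (hj : ∀ y, (f y).vert (Fin.last n) ∈ (R.triv j).baseSet) :
    Continuous fun z : {z : Y × G // 𝓖.r z.2 = (f z.1).vert (Fin.last n)} =>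
      R.chart j (hj z.1.1) (coneIntegrand ρ w c m (f z.1.1) ⟨z.1.2, z.2⟩) := by
  simp only [coneIntegrand, map_smul]
  refine Continuous.smul (f := fun z : {z : Y × G // 𝓖.r z.2 = (f z.1).vert (Fin.last n)} =>
    ((w (𝓖.s z.1.2) : ℝ) : 𝕂)) (RCLike.continuous_ofReal.comp
    (hw.comp (𝓖.continuous_s.comp (continuous_snd.comp continuous_subtype_val)))) ?_
  have hcone := Nerve.continuous_cone (𝓖 := 𝓖.toTopGroupoid)
    (Y := {z : Y × G // 𝓖.r z.2 = (f z.1).vert (Fin.last n)})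
    (hf.comp (continuous_fst.comp continuous_subtype_val))
    (continuous_snd.comp continuous_subtype_val) fun z => z.2
  rw [continuous_iff_continuousAt]
  intro z
  have h1 := continuousAt_coneSum c hρ m j
    (φ₀ := (f z.1.1).cone ⟨z.1.2, z.2⟩)
    (Set.mem_of_eq_of_mem (Nerve.map_zero_cone _ _) (hU z.1.1))
    ((Nerve.vert_cone_last (f z.1.1) ⟨z.1.2, z.2⟩).symm ▸ hj z.1.1)
  refine (ContinuousAt.comp (f := fun z : {z : Y × G // 𝓖.r z.2 = (f z.1).vert (Fin.last n)} =>
    (f z.1.1).cone ⟨z.1.2, z.2⟩) h1 hcone.continuousAt).congr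
    (Eventually.of_forall fun z => ?_)
  exact congrArg (fun ξ => (R.triv j ξ).2) (tot_coneSum ρ c m _ _).symm

theorem fiberCc_coneIntegrand [T2Space X] [T2Space G]
    (hρ : ∀ n (j : C.J n) (φ : 𝓖.toTopGroupoid.Nerve n), φ ∈ tsupport (ρ n j) → φ ∈ C.U j)
    (hw : Continuous w) (hws : 𝓖.toTopGroupoid.IsCutoffSupported w) (m : C.natural.J n)
    {φ : 𝓖.toTopGroupoid.Nerve n} (hφ : φ ∈ C.natural.U m) :
    R.FiberCc (coneIntegrand ρ w c m φ) := by
  obtain ⟨j, hj⟩ := R.triv_covers (φ.vert (Fin.last n))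
  refine FiberCc.of_chart j hj ?_ (hws.hasCompactSupport fun γ h => ?_)
  · have h := continuous_coneIntegrand c hρ hw m j (Y := Unit) (f := fun _ => φ)
      continuous_const (fun _ => hφ) (fun _ => hj)
    exact h.comp ((continuous_const.prodMk continuous_subtype_val).subtype_mk
      (f := fun γ : 𝓖.toTopGroupoid.Fiber (φ.vert (Fin.last n)) => ((), γ.1)) fun γ => γ.2)
  · simp only [coneIntegrand, h, zero_smul, map_zero]

variable [T2Space X] [LocallyCompactSpace X] [T2Space G] [LocallyCompactSpace G] [NormalSpace G]
  [MeasurableSpace G] [BorelSpace G] (haar : 𝓖.toTopGroupoid.HaarSystem)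

theorem fiberIntegral_coneIntegrand_mem_sections
    (hρ : ∀ n (j : C.J n) (φ : 𝓖.toTopGroupoid.Nerve n), φ ∈ tsupport (ρ n j) → φ ∈ C.U j)
    (hw : Continuous w) (hws : 𝓖.toTopGroupoid.IsCutoffSupported w) (m : C.natural.J n)
    (U : Opens (𝓖.toTopGroupoid.Nerve n)) (hU : ∀ φ ∈ U, φ ∈ C.natural.U m) :
    (fun φ : U => fiberIntegral haar (coneIntegrand ρ w c m φ.1)) ∈ R.sections n U := by
  change Continuous _
  rw [continuous_iff_continuousAt]
  intro φ₀
  obtain ⟨j, hj⟩ := R.triv_covers (φ₀.1.vert (Fin.last n))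
  have hvert : Continuous fun φ : U => φ.1.vert (Fin.last n) :=
    (Nerve.continuous_vertex _).comp continuous_subtype_val
  refine ((R.triv j).tendsto_nhds_iff ((R.triv j).mem_source.2 hj)).2 ⟨hvert.continuousAt, ?_⟩
  -- On this open set the chart `j` turns the integrand into a function with values in the fixed
  -- space `Fin k → 𝕂`, so `continuous_integral_fiber` applies.
  let Y := {φ : U // φ.1.vert (Fin.last n) ∈ (R.triv j).baseSet}
  have hY : IsOpen {φ : U | φ.1.vert (Fin.last n) ∈ (R.triv j).baseSet} :=
    (R.triv j).open_baseSet.preimage hvert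
  have key : Continuous fun y : Y => ∫ γ, R.chart j y.2 (coneIntegrand ρ w c m y.1.1 γ)
      ∂(haar.fiberMeasure (y.1.1.vert (Fin.last n))) := by
    refine haar.continuous_integral_fiber (hvert.comp continuous_subtype_val)
      (fun (y : Y) γ => R.chart j y.2 (coneIntegrand ρ w c m y.1.1 γ)) ?_ fun y => ?_
    · exact continuous_coneIntegrand c hρ hw m j (f := fun y : Y => y.1.1)
        (continuous_subtype_val.comp continuous_subtype_val) (fun y => hU _ y.1.2) fun y => y.2
    · obtain ⟨A, hA, h⟩ := hws.eventually (hvert.comp continuous_subtype_val) y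
      refine ⟨A, hA, h.mono fun y hy γ hγ => ?_⟩
      simp only [coneIntegrand, hy γ hγ, zero_smul, map_zero]
  have h2 := (hY.isOpenEmbedding_subtypeVal).continuousAt_iff (x := ⟨φ₀, hj⟩)
    (g := fun φ : U => (R.triv j ⟨φ.1.vert (Fin.last n),
      fiberIntegral haar (coneIntegrand ρ w c m φ.1)⟩).2)
  refine h2.1 (key.congr fun y => ?_).continuousAt
  exact (map_fiberIntegral haar (fiberCc_coneIntegrand c hρ hw hws m (hU _ y.1.2))
    (R.chart j y.2).toLinearMap).symm

/-- The contraction of the cochain complex: the mean over all cones. -/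
noncomputable def contraction
    (hρ : ∀ n (j : C.J n) (φ : 𝓖.toTopGroupoid.Nerve n), φ ∈ tsupport (ρ n j) → φ ∈ C.U j)
    (hw : Continuous w) (hws : 𝓖.toTopGroupoid.IsCutoffSupported w) (m : C.natural.J n) :
    R.sections n (C.natural.U m) :=
  ⟨_, fiberIntegral_coneIntegrand_mem_sections c haar hρ hw hws m (C.natural.U m) fun _ h => h⟩

/-- The identity `cocycle_eq_sum` is multiplied by `w (s γ)` and integrated over `γ`. Its left side
does not depend on `γ` and yields half of `c m`; its right side yields the differential of the
contraction. -/
theorem dFamily_contraction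
    (hρ : ∀ n (j : C.J n) (φ : 𝓖.toTopGroupoid.Nerve n), φ ∈ tsupport (ρ n j) → φ ∈ C.U j)
    (hw : Continuous w) (hws : 𝓖.toTopGroupoid.IsCutoffSupported w)
    (hw1 : ∀ x, ∫ γ, w (𝓖.s γ.1) ∂(haar.fiberMeasure x) = 1 / 2)
    (hc : ∀ l, R.sheaf.dFamily (n + 1) c l = 0) (m : C.natural.J (n + 1)) :
    R.sheaf.dFamily n (contraction c haar hρ hw hws) m +
      R.sheaf.dFamily n (contraction c haar hρ hw hws) m = c m := by
  suffices h : ∀ {φ : 𝓖.toTopGroupoid.Nerve (n + 1)}, φ ∈ C.natural.U m →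
      R.extend (C.natural.U m) (R.sheaf.dFamily n (contraction c haar hρ hw hws) m) φ rfl =
        ((1 / 2 : ℝ) : 𝕂) • R.extend (C.natural.U m) (c m) φ rfl by
    refine Subtype.ext (funext fun φ => ?_)
    have h1 := (extend_of_mem _ φ.2).symm.trans
      ((h φ.2).trans (congrArg _ (extend_of_mem (c m) φ.2)))
    refine (congrArg₂ (· + ·) h1 h1).trans ?_
    change ((1 / 2 : ℝ) : 𝕂) • (c m).1 φ + ((1 / 2 : ℝ) : 𝕂) • (c m).1 φ = (c m).1 φ
    rw [← add_smul, ← RCLike.ofReal_add, add_halves, RCLike.ofReal_one, one_smul]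
  intro φ hφ
  have hface : ∀ i : Fin (n + 2), φ.map (Fin.succAboveOrderEmb i).toOrderHom ∈
      C.natural.U (C.naturalPre.face (Fin.succAboveOrderEmb i) m) := fun i =>
    C.naturalPre.map_mem (Fin.succAboveOrderEmb i) m φ hφ
  have hcc := fun i => fiberCc_coneIntegrand c hρ hw hws _ (hface i)
  -- Left invariance moves the integral from the fibre over the last vertex of the `i`-th face to
  -- the fibre over the last vertex of `φ`, so that all terms are integrated over the same space.
  have hterm : ∀ i : Fin (n + 2), R.extend
      (C.natural.U (C.naturalPre.face (Fin.succAboveOrderEmb i) m))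
      (contraction c haar hρ hw hws (C.naturalPre.face (Fin.succAboveOrderEmb i) m))
      (φ.map (Fin.succAboveOrderEmb i).toOrderHom) rfl =
      fiberIntegral haar fun γ => coneIntegrand ρ w c
        (C.naturalPre.face (Fin.succAboveOrderEmb i) m)
        (φ.map (Fin.succAboveOrderEmb i).toOrderHom)
        (𝓖.translate (φ.1 (i.succAbove (Fin.last n)) (Fin.last (n + 1))) (φ.s_eq _ _)
                (φ.r_eq _ _) γ) := fun i =>
    (extend_of_mem _ (hface i)).trans (fiberIntegral_translate haar _ _ _ (hcc i)).symm
  rw [extend_dFamily _ _ hφ, ← hw1 (φ.vert (Fin.last (n + 1))), ← fiberIntegral_smul_const]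
  conv_rhs => enter [2, γ]; rw [cocycle_eq_sum hρ c hc m hφ γ, Finset.smul_sum]
  have hcc2 := fun i : Fin (n + 2) => ((hcc i).translate (φ.s_eq (i.succAbove (Fin.last n))
    (Fin.last (n + 1))) (φ.r_eq _ _)).linearMap (((-1 : ℤ) ^ (i : ℕ)) •
      R.act (φ.1 (Fin.last (n + 1)) (i.succAbove (Fin.last n))) (φ.s_eq _ _) (φ.r_eq _ _))
  refine Eq.trans (Finset.sum_congr rfl fun i _ => ?_)
    ((fiberIntegral_sum haar Finset.univ fun i _ => hcc2 i).symm.trans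
      (congrArg (fiberIntegral haar) (funext fun γ => Finset.sum_congr rfl fun i _ => ?_)))
  · refine (congrArg (fun ξ => ((-1 : ℤ) ^ (i : ℕ)) • R.act (φ.1 (Fin.last (n + 1))
      (i.succAbove (Fin.last n))) (φ.s_eq _ _) (φ.r_eq _ _) ξ) (hterm i)).trans ?_
    exact linearMap_fiberIntegral haar ((hcc i).translate (φ.s_eq (i.succAbove (Fin.last n))
      (Fin.last (n + 1))) (φ.r_eq _ _)) (((-1 : ℤ) ^ (i : ℕ)) •
      R.act (φ.1 (Fin.last (n + 1)) (i.succAbove (Fin.last n))) (φ.s_eq _ _) (φ.r_eq _ _))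
  -- Translation preserves sources, so all the summands carry the same factor `w (s γ)`.
  · rw [smul_comm, ← map_smul]
    simp only [coneIntegrand, s_translate]
    rfl

theorem subsingleton_cechHR_sheaf (R : RealRep.{u, u', v} 𝓖 𝕂 bar k)
    (hproper : 𝓖.toTopGroupoid.IsProper)
    (hpara : ∀ n : ℕ, ParacompactSpace (𝓖.toTopGroupoid.Nerve n))
    (hparaOrbit : ParacompactSpace 𝓖.toTopGroupoid.OrbitSpace)
    (haar : 𝓖.toTopGroupoid.HaarSystem) (n : ℕ) : Subsingleton (R.sheaf.CechHR (n + 1)) := by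
  refine R.sheaf.subsingleton_cechHR fun C c hc => ?_
  obtain ⟨w, hw, hws, hw1⟩ := haar.exists_cutoff hproper
  have hpou : ∀ n, ∃ ρ : PartitionOfUnity (C.J n) (𝓖.toTopGroupoid.Nerve n),
      ∀ (j : C.J n) (φ : 𝓖.toTopGroupoid.Nerve n), φ ∈ tsupport (ρ j) → φ ∈ C.U j := by
    intro n
    obtain ⟨ρ, hρ⟩ := PartitionOfUnity.exists_isSubordinate (X := 𝓖.toTopGroupoid.Nerve n)
      isClosed_univ (fun j : C.J n => {φ | φ ∈ C.U j}) (fun j => (C.U j).isOpen)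
      fun φ _ => Set.mem_iUnion.2 (C.covers φ)
    exact ⟨ρ, fun j φ h => hρ j h⟩
  choose ρ hρ using hpou
  -- The cutoff is halved so that the sum of the contraction and its conjugate, rather than their
  -- mean, is the primitive.
  refine R.sheaf.mem_coboundaries_of_dFamily (fun n U x y => sections_add_self_injective x y) c
    (contraction c.1 haar (w := fun x => 1 / 2 * w x) hρ (continuous_const.mul hw) ?_) fun m =>
      dFamily_contraction c.1 haar hρ _ _ (fun x => ?_) (fun l => ?_) m
  · intro K hK
    obtain ⟨A, hA, h⟩ := hws K hK
    exact ⟨A, hA, fun γ hγ h0 => h γ hγ (right_ne_zero_of_mul h0)⟩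
  · rw [integral_const_mul, hw1, mul_one]
  · exact congrFun (congrArg Subtype.val hc) l

end RealRep

theorem mainTheorem5 {X : Type u'} {G : Type u}
    [TopologicalSpace X] [T2Space X] [LocallyCompactSpace X]
    [TopologicalSpace G] [T2Space G] [LocallyCompactSpace G]
    [MeasurableSpace G] [BorelSpace G]
    (𝓖 : RealGroupoid X G)
    (hproper : 𝓖.toTopGroupoid.IsProper)
    (hpara : ∀ n : ℕ, ParacompactSpace (𝓖.toTopGroupoid.Nerve n))
    (hparaOrbit : ParacompactSpace 𝓖.toTopGroupoid.OrbitSpace)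
    (haar : 𝓖.toTopGroupoid.HaarSystem)
    (k : ℕ) :
    (∀ R : RealRep.{u, u', v} 𝓖 ℝ (fun t => -t) k,
      ∀ n : ℕ, 1 ≤ n → Subsingleton (R.sheaf.CechHR n)) ∧
    (∀ R : RealRep.{u, u', v} 𝓖 ℂ (starRingEnd ℂ) k,
      ∀ n : ℕ, 1 ≤ n → Subsingleton (R.sheaf.CechHR n)) := by
  have : NormalSpace G := 𝓖.toTopGroupoid.normalSpace_of_paracompactSpace_nerve_one
  constructor
  all_goals
    intro R n hn
    obtain ⟨n, rfl⟩ := Nat.exists_eq_add_of_le' hn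
    exact R.subsingleton_cechHR_sheaf hproper hpara hparaOrbit haar n
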